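/- Let $k$ be a field, let $m,n>1$ be integers, and let $y$ be the Vigenère ciphertext, over the alphabet $\mathscr A=\mathbb Z/n$, of some plaintext $x=(x_0,\dots,x_{N-1})$ under a key $K=(k_1,\dots,k_m)$, that is, $y_t=x_t+k_{(t \bmod m)+1}$. For $1\le i\le m$ let $y_i$ be the list of the letters of $y$ at the positions $t\equiv i-1 \pmod m$, and let $f_{i,j}$ be the number of occurrences of the letter $j\in\mathscr A$ in $y_i$. Assume that every $y_i$ has length greater than $1$ and that every letter of $\mathscr A$ occurs more than once in $y$. Let $\mathfrak C$ be the Brauer configuration whose vertices are the letters $j\in\mathscr A$, whose polygons are the multisets $y_1,\dots,y_m$, whose multiplicity function is $\mu\equiv 1$, and in which the successor sequence of $j$ lists $y_1$ $f_{1,j}$ times, then $y_2$ $f_{2,j}$ times, and so on up to $y_m$, and is closed up to a circular order. Let $\Lambda_{\mathfrak C}=kQ/I$ be its Brauer configuration algebra: $Q$ has the polygons as vertices and, for each letter and each two consecutive places of its circular order, an arrow from the polygon at the first place to the polygon at the second; the special cycle at a place of the circular order of $j$ is the closed path in $Q$ that starts there and runs once around the circular order; and $I$ is generated by all differences $C-C'$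 of special cycles starting at the same polygon, all products $Ca$ of a special cycle $C$ with its first arrow $a$, and all paths $ab$ of two arrows that are not consecutive in a circular order. Let $Z(\Lambda_{\mathfrak C})$ be the center of $\Lambda_{\mathfrak C}$. (a) If every letter of $\mathscr A$ occurs in every list $y_i$, then $$\dim_k Z(\Lambda_{\mathfrak C})=1+m+\sum_{i=1}^m\sum_{j\in\mathscr A}(f_{i,j}-1).$$ (b) More generally, if $\mathfrak C$ is connected (any two polygons are linked by a chain of polygons in which consecutive ones have a common letter) and every letter of $\mathscr A$ occurs in at least two of the lists $y_1,\dots,y_m$, then $$\dim_k Z(\Lambda_{\mathfrak C})=1+m+\sum_{i=1}^m\ \sum_{j\in\mathscr A,\ f_{i,j}\ge 1}(f_{i,j}-1).$$ -/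

import Mathlib

noncomputable section

set_option linter.unusedSectionVars false

universe u v w

/-! ### The path algebra of a quiver with finitely many vertices -/

/-- The path algebra `kQ` of a quiver with finitely many vertices. An element is a finite formal
`k`-linear combination of paths, stored as a family of linear combinations of paths from `i` to `j`,
one for each pair of vertices `i, j`. -/
@[ext]
structure PathAlgebra (k : Type u) [Field k] (Q : Type v) [Quiver.{w} Q] where
  /-- The component spanned by the paths from `i` to `j`. -/
  comp : ∀ i j : Q, Quiver.Path i j →₀ k

namespace PathAlgebra

variable {k : Type u} [Field k] {Q : Type v} [Quiver.{w} Q]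

instance : Zero (PathAlgebra k Q) := ⟨⟨fun _ _ => 0⟩⟩
instance : Add (PathAlgebra k Q) := ⟨fun a b => ⟨fun i j => a.comp i j + b.comp i j⟩⟩
instance : Neg (PathAlgebra k Q) := ⟨fun a => ⟨fun i j => -a.comp i j⟩⟩
instance : Sub (PathAlgebra k Q) := ⟨fun a b => ⟨fun i j => a.comp i j - b.comp i j⟩⟩
instance : SMul k (PathAlgebra k Q) := ⟨fun c a => ⟨fun i j => c • a.comp i j⟩⟩
instance : SMul ℕ (PathAlgebra k Q) := ⟨fun c a => ⟨fun i j => c • a.comp i j⟩⟩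
instance : SMul ℤ (PathAlgebra k Q) := ⟨fun c a => ⟨fun i j => c • a.comp i j⟩⟩

theorem comp_injective : Function.Injective (PathAlgebra.comp : PathAlgebra k Q → _) :=
  fun _ _ h => PathAlgebra.ext h

instance : AddCommGroup (PathAlgebra k Q) :=
  comp_injective.addCommGroup _ rfl (fun _ _ => rfl) (fun _ => rfl) (fun _ _ => rfl)
    (fun _ _ => rfl) (fun _ _ => rfl)

/-- `comp` as an additive homomorphism. -/
def compHom : PathAlgebra k Q →+ ∀ i j : Q, Quiver.Path i j →₀ k where
  toFun := comp
  map_zero' := rfl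
  map_add' _ _ := rfl

instance : Module k (PathAlgebra k Q) :=
  comp_injective.module k compHom (fun _ _ => rfl)

/-- Concatenation of paths, extended bilinearly. -/
def concat {i j l : Q} :
    (Quiver.Path i j →₀ k) →ₗ[k] (Quiver.Path j l →₀ k) →ₗ[k] (Quiver.Path i l →₀ k) :=
  Finsupp.linearCombination k fun p => Finsupp.lmapDomain k k fun q => p.comp q

theorem concat_single {i j l : Q} (p : Quiver.Path i j) (q : Quiver.Path j l) (c d : k) :
    concat (Finsupp.single p c) (Finsupp.single q d) = Finsupp.single (p.comp q) (c * d) := by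
  simp [concat, Finsupp.mapDomain_single]

theorem concat_assoc {i j l r : Q} (f : Quiver.Path i j →₀ k) (g : Quiver.Path j l →₀ k)
    (h : Quiver.Path l r →₀ k) : concat (concat f g) h = concat f (concat g h) := by
  induction f using Finsupp.induction_linear with
  | zero => simp
  | add f₁ f₂ h₁ h₂ => simp only [map_add, LinearMap.add_apply, h₁, h₂]
  | single p c =>
    induction g using Finsupp.induction_linear with
    | zero => simp
    | add f₁ f₂ h₁ h₂ => simp only [map_add, LinearMap.add_apply, h₁, h₂]
    | single q d =>
      induction h using Finsupp.induction_linear with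
      | zero => simp
      | add f₁ f₂ h₁ h₂ => simp only [map_add, h₁, h₂]
      | single s e => simp only [concat_single, Quiver.Path.comp_assoc, mul_assoc]

theorem nil_concat {i j : Q} (f : Quiver.Path i j →₀ k) :
    concat (Finsupp.single Quiver.Path.nil 1) f = f := by
  induction f using Finsupp.induction_linear with
  | zero => simp
  | add f₁ f₂ h₁ h₂ => simp only [map_add, h₁, h₂]
  | single p c => simp only [concat_single, Quiver.Path.nil_comp, one_mul]

theorem concat_nil {i j : Q} (f : Quiver.Path i j →₀ k) :
    concat f (Finsupp.single Quiver.Path.nil 1) = f := by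
  induction f using Finsupp.induction_linear with
  | zero => simp
  | add f₁ f₂ h₁ h₂ => simp only [map_add, LinearMap.add_apply, h₁, h₂]
  | single p c => simp only [concat_single, Quiver.Path.comp_nil, mul_one]

variable [DecidableEq Q]

/-- The basis element of the path algebra given by a path `p` from `i` to `j`: its component at
`(i, j)` is `p` and all other components are zero. -/
def ofPath {i j : Q} (p : Quiver.Path i j) : PathAlgebra k Q :=
  ⟨fun i' j' => if h : i = i' ∧ j = j' then Finsupp.single (p.cast h.1 h.2) 1 else 0⟩

variable [Fintype Q]

/-- The product is the bilinear extension of the concatenation of paths; products of non-composable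
paths are zero. -/
instance : Mul (PathAlgebra k Q) := ⟨fun a b => ⟨fun i j => ∑ l, concat (a.comp i l) (b.comp l j)⟩⟩

/-- The unit is the sum of the trivial paths. -/
instance : One (PathAlgebra k Q) :=
  ⟨⟨fun i j => if h : i = j then Finsupp.single (Quiver.Path.nil.cast rfl h) 1 else 0⟩⟩

theorem mul_comp (a b : PathAlgebra k Q) (i j : Q) :
    (a * b).comp i j = ∑ l, concat (a.comp i l) (b.comp l j) := rfl

theorem one_comp_self (i : Q) :
    (1 : PathAlgebra k Q).comp i i = Finsupp.single Quiver.Path.nil 1 :=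
  dif_pos rfl

theorem one_comp_of_ne {i j : Q} (h : i ≠ j) : (1 : PathAlgebra k Q).comp i j = 0 :=
  dif_neg h

theorem add_comp (a b : PathAlgebra k Q) (i j : Q) :
    (a + b).comp i j = a.comp i j + b.comp i j := rfl

theorem zero_comp (i j : Q) : (0 : PathAlgebra k Q).comp i j = 0 := rfl

theorem smul_comp (c : k) (a : PathAlgebra k Q) (i j : Q) : (c • a).comp i j = c • a.comp i j :=
  rfl

instance : Ring (PathAlgebra k Q) :=
  { (inferInstance : AddCommGroup (PathAlgebra k Q)) with
    mul := (· * ·)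
    one := 1
    mul_assoc := fun a b c => by
      ext1
      funext i j
      simp only [mul_comp, map_sum, LinearMap.sum_apply, concat_assoc]
      exact Finset.sum_comm
    one_mul := fun a => by
      ext1
      funext i j
      rw [mul_comp, Finset.sum_eq_single i]
      · rw [one_comp_self, nil_concat]
      · intro l _ hl
        rw [one_comp_of_ne hl.symm, map_zero, LinearMap.zero_apply]
      · simp
    mul_one := fun a => by
      ext1
      funext i j
      rw [mul_comp, Finset.sum_eq_single j]
      · rw [one_comp_self, concat_nil]
      · intro l _ hl
        rw [one_comp_of_ne hl, map_zero]
      · simp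
    left_distrib := fun a b c => by
      ext1
      funext i j
      simp only [mul_comp, add_comp, map_add, Finset.sum_add_distrib]
    right_distrib := fun a b c => by
      ext1
      funext i j
      simp only [mul_comp, add_comp, map_add, LinearMap.add_apply, Finset.sum_add_distrib]
    zero_mul := fun a => by
      ext1
      funext i j
      simp only [mul_comp, zero_comp, map_zero, LinearMap.zero_apply, Finset.sum_const_zero]
    mul_zero := fun a => by
      ext1
      funext i j
      simp only [mul_comp, zero_comp, map_zero, Finset.sum_const_zero] }

instance : Algebra k (PathAlgebra k Q) :=
  Algebra.ofModule
    (fun c a b => by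
      ext1
      funext i j
      simp only [mul_comp, smul_comp, map_smul, LinearMap.smul_apply, Finset.smul_sum])
    (fun c a b => by
      ext1
      funext i j
      simp only [mul_comp, smul_comp, map_smul, Finset.smul_sum])

end PathAlgebra

/-! ### Brauer configurations -/

/-- A Brauer configuration with vertex set `V` and finitely many polygons, indexed by `ι`, all of
whose vertices are non-truncated. -/
structure BrauerConfiguration (V : Type u) [DecidableEq V] (ι : Type v) [Fintype ι]
    [DecidableEq ι] where
  /-- The polygons: finite multisets of vertices. -/
  polygon : ι → Multiset V
  /-- Each polygon has more than one element, counted with multiplicity. -/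
  one_lt_card : ∀ i, 1 < (polygon i).card
  /-- The multiplicity function. -/
  μ : V → ℕ
  /-- Multiplicities are positive. -/
  μ_pos : ∀ a, 0 < μ a
  /-- The orientation: the successor sequence of each vertex `a`, that is, the list of the polygons
  containing `a`. The cyclic order at `a` is obtained by letting the first
  entry follow the last one. -/
  succSeq : V → List ι
  /-- A polygon is listed as many times as `a` occurs in it. -/
  count_succSeq : ∀ a i, (succSeq a).count i = (polygon i).count a
  /-- Every vertex is non-truncated: `μ(a) val(a) > 1`. -/
  nontruncated : ∀ a, 1 < μ a * ∑ i, (polygon i).count a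

namespace BrauerConfiguration

variable {V : Type u} [DecidableEq V] {ι : Type v} [Fintype ι] [DecidableEq ι]
  (Γ : BrauerConfiguration V ι)

/-- The valency of a vertex: its number of occurrences in all polygons. -/
def val (a : V) : ℕ := ∑ i, (Γ.polygon i).count a

theorem length_succSeq (a : V) : (Γ.succSeq a).length = Γ.val a := by
  unfold val
  simp_rw [← Γ.count_succSeq]
  have h := Multiset.sum_count_eq_card (s := Finset.univ) (m := (Γ.succSeq a : Multiset ι))
    (fun _ _ => Finset.mem_univ _)
  simpa using h.symm

/-- The places of the circular orders: a vertex `a` together with a place in its successor sequence,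
i.e. an occurrence of `a` in a polygon. Each of them is the start of one arrow of the
Brauer quiver, so this is also the set of arrows. -/
def Place : Type u := Σ a : V, Fin (Γ.succSeq a).length

variable {Γ} in
/-- The polygon at a given place. -/
def Place.poly (x : Γ.Place) : ι := (Γ.succSeq x.1).get x.2

variable {Γ} in
/-- The place following `x` in the circular order. -/
def Place.next (x : Γ.Place) : Γ.Place :=
  ⟨x.1, ⟨(x.2 + 1) % (Γ.succSeq x.1).length, Nat.mod_lt _ (Nat.zero_lt_of_lt x.2.isLt)⟩⟩

/-- The vertices of the Brauer quiver are the polygons. -/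
def QVertex (_ : BrauerConfiguration V ι) : Type v := ι

instance : Fintype Γ.QVertex := inferInstanceAs (Fintype ι)
instance : DecidableEq Γ.QVertex := inferInstanceAs (DecidableEq ι)

/-- The Brauer quiver: one arrow for each place `x`, from the polygon at `x` to the polygon
at the following place. -/
instance : Quiver Γ.QVertex where
  Hom i j := {x : Γ.Place // x.poly = i ∧ x.next.poly = j}

variable {Γ} in
/-- The arrow of the Brauer quiver that starts at the place `x`. -/
def Place.hom (x : Γ.Place) :
    (show Γ.QVertex from x.poly) ⟶ (show Γ.QVertex from x.next.poly) := ⟨x, rfl, rfl⟩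

variable (k : Type w) [Field k]

variable {Γ} in
/-- The arrow that starts at `x`, as an element of the path algebra of the Brauer quiver. -/
def Place.arrow (x : Γ.Place) : PathAlgebra k Γ.QVertex :=
  PathAlgebra.ofPath x.hom.toPath

variable {Γ} in
/-- The special cycle that starts at `x`: the path that runs once around the circular order. -/
def Place.cycle (x : Γ.Place) : PathAlgebra k Γ.QVertex :=
  ((List.range (Γ.val x.1)).map fun t => (Place.next^[t] x).arrow k).prod

/-- The relations of the Brauer configuration algebra. -/
inductive Relations : Set (PathAlgebra k Γ.QVertex)
  /-- Powers of special cycles at the same polygon are identified. -/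
  | cycle_sub (x y : Γ.Place) (h : x.poly = y.poly) :
      Relations (x.cycle k ^ Γ.μ x.1 - y.cycle k ^ Γ.μ y.1)
  /-- The power of a special cycle followed by its first arrow. -/
  | cycle_mul (x : Γ.Place) : Relations (x.cycle k ^ Γ.μ x.1 * x.arrow k)
  /-- Composable arrows that are not consecutive in a special cycle. -/
  | arrow_mul (x y : Γ.Place) (h : x.next.poly = y.poly) (hne : y ≠ x.next) :
      Relations (x.arrow k * y.arrow k)

/-- The Brauer configuration algebra: the quotient of the path algebra of the Brauer quiver by the
two-sided ideal generated by the relations. -/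
abbrev BrauerAlgebra : Type _ := RingQuot fun a b => a ∈ Γ.Relations k ∧ b = 0

/-- A Brauer configuration is connected if any two polygons are linked by a chain of polygons in
which consecutive ones have a common vertex. -/
def IsConnected : Prop :=
  (SimpleGraph.fromRel fun i j => ∃ a, a ∈ Γ.polygon i ∧ a ∈ Γ.polygon j).Connected

end BrauerConfiguration

/-! ### The Vigenère cryptosystem -/

namespace Vigenere

variable {m n N : ℕ} [NeZero m]

/-- Vigenère encryption over the alphabet `ℤ/n` with key `K` of length `m` of a plaintext `x` of
length `N`: the key is repeated periodically and added. -/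
def encrypt (K : Fin m → ZMod n) (x : Fin N → ZMod n) : Fin N → ZMod n :=
  fun t => x t + K (Fin.ofNat m t.val)

/-- The `i`-th list of a text `y`: its letters at the positions congruent to `i` modulo `m`. -/
def block (m : ℕ) [NeZero m] (y : Fin N → ZMod n) (i : Fin m) : List (ZMod n) :=
  ((List.finRange N).filter fun t : Fin N => Fin.ofNat m t.val = i).map y

theorem sum_count_block (y : Fin N → ZMod n) (j : ZMod n) :
    ∑ i, (block m y i).count j = (List.ofFn y).count j := by
  rw [List.ofFn_eq_map]
  unfold block
  induction List.finRange N with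
  | nil => simp
  | cons t l ih =>
    rw [List.map_cons, List.count_cons, ← ih]
    have h : ∀ i : Fin m, (((t :: l).filter fun t : Fin N => Fin.ofNat m t.val = i).map y).count j =
        ((l.filter fun t : Fin N => Fin.ofNat m t.val = i).map y).count j +
          if i = Fin.ofNat m t.val then (if y t == j then 1 else 0) else 0 := by
      intro i
      by_cases hi : Fin.ofNat m t.val = i
      · rw [List.filter_cons_of_pos (by simpa using hi), List.map_cons, List.count_cons,
          if_pos hi.symm]
      · rw [List.filter_cons_of_neg (by simpa using hi), if_neg (Ne.symm hi), Nat.add_zero]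
    simp only [h, Finset.sum_add_distrib]
    simp

/-- The Brauer configuration of a text `y` and a key length `m`: the vertices are the letters, the
polygons are the lists `y₁, …, yₘ`, all multiplicities are `1`, and the successor
sequences are ordered by `y₁ < ⋯ < yₘ`. -/
def configuration (m : ℕ) [NeZero m] (y : Fin N → ZMod n)
    (hlen : ∀ i, 1 < (block m y i).length) (hfreq : ∀ j, 1 < (List.ofFn y).count j) :
    BrauerConfiguration (ZMod n) (Fin m) where
  polygon i := (block m y i : Multiset (ZMod n))
  one_lt_card i := by simpa using hlen i
  μ _ := 1
  μ_pos _ := Nat.one_pos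
  succSeq j := (List.finRange m).flatMap fun i => List.replicate ((block m y i).count j) i
  count_succSeq j i := by
    rw [List.count_flatMap, ← List.ofFn_eq_map, List.sum_ofFn]
    simp [List.count_replicate]
  nontruncated j := by
    have h := hfreq j
    rw [← sum_count_block (m := m)] at h
    simpa using h

end Vigenere

end

noncomputable section

set_option linter.unusedSectionVars false

universe u v w

/-! When all multiplicities are 1, the Brauer configuration algebra has a basis of normal words: the
trivial paths, the proper runs (paths of consecutive arrows in the circular order of a letter,
shorter than a full turn), and one socle element per polygon, the common value of its special
cycles. The relations make these words span. They are independent because left multiplication on the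
space of labels respects the relations (`pathAction_relations`) and, applied to the label of the
unit, returns the coefficients (`normalForm`, inverted on the left by `ofForm_normalForm`). Right
multiplication becomes an explicit operator as well, since it commutes with the left one.

Centrality is then a comparison of coefficients (`mem_center_iff_normalForm`). Commuting with an
arrow forces equal coefficients at the trivial paths of its two ends, so by connectedness these
paths contribute only a multiple of 1. A run that lacks at least two arrows of its cycle has
coefficient zero: extending it on the right gives a proper run that no left multiplication by the
same arrow can produce. A run that lacks exactly one arrow must be closed, so the missing arrow is a
loop. Conversely, 1, the socle elements and the complements of loops are central, and they are
independent. The dimension is therefore 1 + (number of polygons) + (number of loops), which is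
`finrank_center`.

The loops are counted letter by letter (`card_loops`). The successor sequence of a letter is sorted,
so a polygon with f occurrences yields f - 1 loops from its inner steps. The closing step of the
circular order yields none, because at least two polygons contain the letter. -/

namespace PathAlgebra

/-! ### Products of paths and generators of the path algebra -/

variable {k : Type u} [Field k] {Q : Type v} [Quiver.{w} Q]

/-- The component of an element of the path algebra at a pair of vertices, as a linear map. -/
def compLinear (i j : Q) : PathAlgebra k Q →ₗ[k] Quiver.Path i j →₀ k where
  toFun a := a.comp i j
  map_add' _ _ := rfl
  map_smul' _ _ := rfl

theorem compLinear_apply (a : PathAlgebra k Q) (i j : Q) : compLinear i j a = a.comp i j := rfl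

theorem sum_comp {α : Type*} (s : Finset α) (g : α → PathAlgebra k Q) (i j : Q) :
    (∑ x ∈ s, g x).comp i j = ∑ x ∈ s, (g x).comp i j :=
  map_sum (compLinear i j) g s

variable [DecidableEq Q]

theorem ofPath_comp_self {i j : Q} (p : Quiver.Path i j) :
    (ofPath p : PathAlgebra k Q).comp i j = Finsupp.single p 1 :=
  dif_pos ⟨rfl, rfl⟩

theorem ofPath_comp_of_ne {i j i' j' : Q} (p : Quiver.Path i j) (h : ¬(i = i' ∧ j = j')) :
    (ofPath p : PathAlgebra k Q).comp i' j' = 0 :=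
  dif_neg h

variable [Fintype Q]

theorem ofPath_mul_ofPath {i j l : Q} (p : Quiver.Path i j) (q : Quiver.Path j l) :
    (ofPath p * ofPath q : PathAlgebra k Q) = ofPath (p.comp q) := by
  ext1
  funext i' l'
  rw [mul_comp, Finset.sum_eq_single j]
  · by_cases h : i = i' ∧ l = l'
    · obtain ⟨rfl, rfl⟩ := h
      simp only [ofPath_comp_self, concat_single, mul_one]
    · rw [ofPath_comp_of_ne _ h]
      rcases not_and_or.1 h with h | h
      · rw [ofPath_comp_of_ne p (fun h' => h h'.1), map_zero, LinearMap.zero_apply]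
      · rw [ofPath_comp_of_ne q (fun h' => h h'.2), map_zero]
  · intro r _ hr
    rw [ofPath_comp_of_ne p (fun h' => hr h'.2.symm), map_zero, LinearMap.zero_apply]
  · simp

theorem ofPath_mul_ofPath_of_ne {i j j' l : Q} (p : Quiver.Path i j) (q : Quiver.Path j' l)
    (h : j ≠ j') : (ofPath p * ofPath q : PathAlgebra k Q) = 0 := by
  ext1
  funext i' l'
  rw [mul_comp, zero_comp]
  refine Finset.sum_eq_zero fun r _ => ?_
  by_cases hr : j = r
  · rw [ofPath_comp_of_ne q (fun h' => h (hr.trans h'.1.symm)), map_zero]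
  · rw [ofPath_comp_of_ne p (fun h' => hr h'.2), map_zero, LinearMap.zero_apply]

theorem sum_ofPath_nil :
    ∑ i : Q, (ofPath (Quiver.Path.nil : Quiver.Path i i) : PathAlgebra k Q) = 1 := by
  ext1
  funext i j
  rw [sum_comp]
  by_cases h : i = j
  · subst h
    rw [one_comp_self, Finset.sum_eq_single i, ofPath_comp_self]
    · intro r _ hr
      exact ofPath_comp_of_ne _ fun h' => hr h'.1
    · simp
  · rw [one_comp_of_ne h]
    exact Finset.sum_eq_zero fun r _ => ofPath_comp_of_ne _ fun h' => h (h'.1.symm.trans h'.2)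

theorem eq_sum_ofPath (a : PathAlgebra k Q) :
    a = ∑ i, ∑ j, (a.comp i j).sum fun p c => c • ofPath p := by
  ext1
  funext i j
  have key : ∀ i' j' : Q, compLinear i j ((a.comp i' j').sum fun p c =>
      c • (ofPath p : PathAlgebra k Q)) =
      if i' = i ∧ j' = j then a.comp i j else 0 := by
    intro i' j'
    rw [Finsupp.sum, map_sum]
    split_ifs with h
    · obtain ⟨rfl, rfl⟩ := h
      simp only [map_smul, compLinear_apply, ofPath_comp_self, Finsupp.smul_single, smul_eq_mul,
        mul_one]
      exact Finsupp.sum_single _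
    · refine Finset.sum_eq_zero fun p _ => ?_
      rw [map_smul, compLinear_apply, ofPath_comp_of_ne _ h, smul_zero]
  rw [← compLinear_apply (∑ i, ∑ j, _)]
  simp only [map_sum, key]
  rw [Finset.sum_eq_single i, Finset.sum_eq_single j]
  · simp
  · intro r _ hr
    simp [hr]
  · simp
  · intro r _ hr
    simp [hr]
  · simp

/-- The path algebra is spanned by the paths. -/
theorem mem_of_forall_ofPath_mem (S : Submodule k (PathAlgebra k Q))
    (h : ∀ {i j : Q} (p : Quiver.Path i j), ofPath p ∈ S) (a : PathAlgebra k Q) : a ∈ S := by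
  rw [eq_sum_ofPath a]
  exact Submodule.sum_mem _ fun i _ => Submodule.sum_mem _ fun j _ =>
    Submodule.sum_mem _ fun p _ => Submodule.smul_mem _ _ (h p)

/-- The path algebra is generated by the trivial paths and the arrows. -/
theorem mem_of_generators_mem (S : Subalgebra k (PathAlgebra k Q))
    (hnil : ∀ i : Q, ofPath (Quiver.Path.nil : Quiver.Path i i) ∈ S)
    (harrow : ∀ {i j : Q} (e : i ⟶ j), ofPath e.toPath ∈ S) (a : PathAlgebra k Q) : a ∈ S := by
  refine mem_of_forall_ofPath_mem (Subalgebra.toSubmodule S) (fun {i j} p => ?_) a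
  rw [Subalgebra.mem_toSubmodule]
  induction p with
  | nil => exact hnil i
  | cons p e ih =>
    have : (ofPath (p.cons e) : PathAlgebra k Q) = ofPath p * ofPath e.toPath := by
      rw [ofPath_mul_ofPath]; rfl
    rw [this]
    exact S.mul_mem ih (harrow e)

/-! ### The universal property of the path algebra -/

section Lift

variable {A : Type*} [Ring A] [Algebra k A]

/-- The value of a path under an assignment of values to vertices and arrows. -/
def pathValue (e : Q → A) (f : ∀ i j : Q, (i ⟶ j) → A) {i : Q} : ∀ {j : Q}, Quiver.Path i j → A
  | _, .nil => e i
  | _, .cons p a => pathValue e f p * f _ _ a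

theorem pathValue_mul_vertex {e : Q → A} {f : ∀ i j : Q, (i ⟶ j) → A} (he : ∀ i, e i * e i = e i)
    (hr : ∀ i j a, f i j a * e j = f i j a) {i j : Q} (p : Quiver.Path i j) :
    pathValue e f p * e j = pathValue e f p := by
  cases p with
  | nil => exact he i
  | cons p a => rw [pathValue, mul_assoc, hr]

/-- A path value begins with the factor `e i` by construction, so no absorption law for arrows on
the left is needed. -/
theorem vertex_mul_pathValue {e : Q → A} {f : ∀ i j : Q, (i ⟶ j) → A} (he : ∀ i, e i * e i = e i)
    {i j : Q} (p : Quiver.Path i j) :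
    e i * pathValue e f p = pathValue e f p := by
  induction p with
  | nil => exact he i
  | cons p a ih => rw [pathValue, ← mul_assoc, ih]

theorem pathValue_comp {e : Q → A} {f : ∀ i j : Q, (i ⟶ j) → A} (he : ∀ i, e i * e i = e i)
    (hr : ∀ i j a, f i j a * e j = f i j a) {i j l : Q} (p : Quiver.Path i j)
    (q : Quiver.Path j l) :
    pathValue e f (p.comp q) = pathValue e f p * pathValue e f q := by
  induction q with
  | nil => exact (pathValue_mul_vertex he hr p).symm
  | cons q a ih => rw [Quiver.Path.comp_cons, pathValue, pathValue, ih, mul_assoc]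

/-- The linear extension of `pathValue` to the path algebra. -/
def liftLinear (e : Q → A) (f : ∀ i j : Q, (i ⟶ j) → A) : PathAlgebra k Q →ₗ[k] A :=
  ∑ i, ∑ j, (Finsupp.linearCombination k fun p : Quiver.Path i j => pathValue e f p) ∘ₗ
    compLinear i j

theorem liftLinear_ofPath (e : Q → A) (f : ∀ i j : Q, (i ⟶ j) → A) {i j : Q}
    (p : Quiver.Path i j) :
    liftLinear e f (ofPath p : PathAlgebra k Q) = pathValue e f p := by
  simp only [liftLinear, LinearMap.sum_apply, LinearMap.comp_apply, compLinear_apply]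
  rw [Finset.sum_eq_single i, Finset.sum_eq_single j]
  · rw [ofPath_comp_self, Finsupp.linearCombination_single, one_smul]
  · intro r _ hr
    rw [ofPath_comp_of_ne _ (fun h => hr h.2.symm), map_zero]
  · simp
  · intro r _ hr
    refine Finset.sum_eq_zero fun s _ => ?_
    rw [ofPath_comp_of_ne _ (fun h => hr h.1.symm), map_zero]
  · simp

/-- The universal property of the path algebra: a complete family of orthogonal idempotents indexed
by the vertices, together with compatible values of the arrows, extends to an algebra
homomorphism. -/
def lift (e : Q → A) (f : ∀ i j : Q, (i ⟶ j) → A) (he : ∀ i, e i * e i = e i)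
    (horth : ∀ i j, i ≠ j → e i * e j = 0) (hone : ∑ i, e i = 1)
    (hr : ∀ i j a, f i j a * e j = f i j a) :
    PathAlgebra k Q →ₐ[k] A :=
  AlgHom.ofLinearMap (liftLinear e f)
    (by
      rw [← sum_ofPath_nil, map_sum, ← hone]
      exact Finset.sum_congr rfl fun i _ => liftLinear_ofPath e f _)
    (by
      intro a b
      have h : ∀ {i j : Q} (p : Quiver.Path i j) (b : PathAlgebra k Q),
          liftLinear e f (ofPath p * b) =
            liftLinear e f (ofPath p : PathAlgebra k Q) * liftLinear e f b := by
        intro i j p b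
        refine mem_of_forall_ofPath_mem (LinearMap.eqLocus
          (liftLinear e f ∘ₗ LinearMap.mulLeft k (ofPath p))
          (LinearMap.mulLeft k (liftLinear e f (ofPath p : PathAlgebra k Q)) ∘ₗ liftLinear e f)) ?_ b
        intro j' l q
        simp only [LinearMap.mem_eqLocus, LinearMap.comp_apply, LinearMap.mulLeft_apply,
          liftLinear_ofPath]
        by_cases hj : j = j'
        · subst hj
          rw [ofPath_mul_ofPath, liftLinear_ofPath, pathValue_comp he hr]
        -- For non-composable paths, the idempotents at the end of `p` and at the start of `q` are
        -- inserted between the two values; they are orthogonal.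
        · rw [ofPath_mul_ofPath_of_ne _ _ hj, map_zero, ← pathValue_mul_vertex he hr p,
            ← vertex_mul_pathValue he q, mul_assoc, ← mul_assoc (e j), horth _ _ hj, zero_mul,
            mul_zero]
      refine mem_of_forall_ofPath_mem (LinearMap.eqLocus
          (liftLinear e f ∘ₗ LinearMap.mulRight k b)
          (LinearMap.mulRight k (liftLinear e f b) ∘ₗ liftLinear e f)) ?_ a
      intro i j p
      simp only [LinearMap.mem_eqLocus, LinearMap.comp_apply, LinearMap.mulRight_apply, h])

theorem lift_nil (e : Q → A) (f : ∀ i j : Q, (i ⟶ j) → A) (he horth hone hr) (i : Q) :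
    lift (k := k) e f he horth hone hr (ofPath (Quiver.Path.nil : Quiver.Path i i)) = e i :=
  liftLinear_ofPath e f _

/-- An arrow, seen as a path, has the value `e i * f i j a`; `hl` removes the extra idempotent. -/
theorem lift_toPath (e : Q → A) (f : ∀ i j : Q, (i ⟶ j) → A) (he horth hone hr) {i j : Q}
    (a : i ⟶ j) (hl : e i * f i j a = f i j a) :
    lift (k := k) e f he horth hone hr (ofPath a.toPath) = f i j a :=
  (liftLinear_ofPath e f _).trans hl

end Lift

end PathAlgebra

namespace BrauerConfiguration

variable {V : Type u} [DecidableEq V] {ι : Type v} [Fintype ι] [DecidableEq ι]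
  {Γ : BrauerConfiguration V ι}

/-! ### Places and their circular orders -/

namespace Place

/-- The polygon at a place, as a vertex of the Brauer quiver. -/
def source (x : Γ.Place) : Γ.QVertex := x.poly

theorem next_iterate (x : Γ.Place) (t : ℕ) :
    next^[t] x = ⟨x.1, ⟨(x.2 + t) % (Γ.succSeq x.1).length,
      Nat.mod_lt _ (Nat.zero_lt_of_lt x.2.isLt)⟩⟩ := by
  induction t with
  | zero =>
    obtain ⟨a, t, ht⟩ := x
    simp only [Nat.add_zero, Nat.mod_eq_of_lt ht]
    rfl
  | succ t ih =>
    rw [Function.iterate_succ_apply', ih]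
    simp only [next, Nat.mod_add_mod, add_assoc]
    rfl

@[simp]
theorem next_fst (x : Γ.Place) : x.next.1 = x.1 := rfl

@[simp]
theorem next_iterate_fst (x : Γ.Place) (t : ℕ) : (next^[t] x).1 = x.1 := by
  rw [next_iterate]

theorem next_iterate_val (x : Γ.Place) : next^[Γ.val x.1] x = x := by
  rw [next_iterate]
  obtain ⟨a, t, ht⟩ := x
  have h : (t + Γ.val a) % (Γ.succSeq a).length = t := by
    rw [← Γ.length_succSeq, Nat.add_mod_right, Nat.mod_eq_of_lt ht]
  simp only [h]
  rfl

theorem next_iterate_ne (x : Γ.Place) {t : ℕ} (h0 : 0 < t) (ht : t < Γ.val x.1) :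
    next^[t] x ≠ x := by
  rw [next_iterate]
  obtain ⟨a, s, hs⟩ := x
  rw [← Γ.length_succSeq] at ht
  intro h
  have h' : (s + t) % (Γ.succSeq a).length = s := by
    simpa using congrArg (fun y : Γ.Place => (y.2 : ℕ)) h
  dsimp only at ht
  rcases lt_or_ge (s + t) (Γ.succSeq a).length with hlt | hge
  · rw [Nat.mod_eq_of_lt hlt] at h'
    omega
  · rw [Nat.mod_eq_sub_mod hge, Nat.mod_eq_of_lt (by omega)] at h'
    omega

theorem val_pos (x : Γ.Place) : 0 < Γ.val x.1 := by
  rw [← Γ.length_succSeq]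
  exact Nat.zero_lt_of_lt x.2.isLt

/-- A full turn is the identity, so running the rest of the circle from `x.next` recovers `x`. -/
theorem next_injective : Function.Injective (next : Γ.Place → Γ.Place) := by
  intro x y h
  have hxy : x.1 = y.1 := by rw [← next_fst x, h, next_fst]
  have hx := next_iterate_val x
  have hy := next_iterate_val y
  obtain ⟨n, hn⟩ := Nat.exists_eq_succ_of_ne_zero (val_pos x).ne'
  rw [hn, Function.iterate_succ_apply, h, ← Function.iterate_succ_apply, ← hn, hxy, hy] at hx
  exact hx.symm

end Place

theorem exists_place_of_mem (Γ : BrauerConfiguration V ι) {i : ι} {a : V} (ha : a ∈ Γ.polygon i) :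
    ∃ x : Γ.Place, x.1 = a ∧ x.poly = i := by
  have hmem : i ∈ Γ.succSeq a := by
    rw [← List.count_pos_iff, Γ.count_succSeq]
    exact Multiset.count_pos.2 ha
  obtain ⟨t, ht⟩ := List.get_of_mem hmem
  exact ⟨⟨a, t⟩, rfl, ht⟩

/-- Every polygon occurs at some place. -/
theorem exists_place (Γ : BrauerConfiguration V ι) (i : Γ.QVertex) :
    ∃ x : Γ.Place, x.source = i := by
  obtain ⟨a, ha⟩ := Multiset.card_pos_iff_exists_mem.1 (Nat.zero_lt_of_lt (Γ.one_lt_card i))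
  obtain ⟨x, -, hx⟩ := Γ.exists_place_of_mem ha
  exact ⟨x, hx⟩

/-- The product of the values of `n` consecutive places, starting at `x`. -/
def runProd {A : Type*} [Monoid A] (f : Γ.Place → A) (x : Γ.Place) (n : ℕ) : A :=
  ((List.range n).map fun t => f (Place.next^[t] x)).prod

section runProd

variable {A B : Type*} [Monoid A] [Monoid B] (f : Γ.Place → A)

theorem runProd_zero (x : Γ.Place) : runProd f x 0 = 1 := rfl

theorem runProd_succ (x : Γ.Place) (n : ℕ) :
    runProd f x (n + 1) = f x * runProd f x.next n := by
  simp [runProd, List.range_succ_eq_map, Function.comp_def]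

theorem runProd_one (x : Γ.Place) : runProd f x 1 = f x := by
  rw [runProd_succ, runProd_zero, mul_one]

theorem runProd_add (x : Γ.Place) (n r : ℕ) :
    runProd f x (n + r) = runProd f x n * runProd f (Place.next^[n] x) r := by
  induction n generalizing x with
  | zero => simp [runProd_zero]
  | succ n ih => rw [Nat.add_right_comm, runProd_succ, ih, runProd_succ, mul_assoc,
      Function.iterate_succ_apply]

theorem map_runProd (g : A →* B) (x : Γ.Place) (n : ℕ) :
    g (runProd f x n) = runProd (fun y => g (f y)) x n := by
  simp [runProd, map_list_prod, Function.comp_def]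

end runProd

/-! ### The regular representation on normal words -/

variable (Γ) in
/-- Labels for a basis of the Brauer configuration algebra with trivial multiplicities. The label
`run x l` stands for the path of length `l + 1` that starts at the place `x`; it is a
basis label only if `l + 1 < val x.1`. -/
inductive NormalWord : Type (max u v)
  | vertex (i : Γ.QVertex)
  | run (x : Γ.Place) (l : ℕ)
  | socle (i : Γ.QVertex)

namespace NormalWord

/-- The vertex at which a word starts. -/
def head : Γ.NormalWord → Γ.QVertex
  | vertex i => i
  | run x _ => x.source
  | socle i => i

/-- The vertex at which a word ends. -/
def tail : Γ.NormalWord → Γ.QVertex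
  | vertex i => i
  | run x l => (Place.next^[l + 1] x).source
  | socle i => i

end NormalWord

open NormalWord Classical

variable (k : Type w) [Field k]

/-- The normal form of the path of length `l + 1` that starts at `x`. -/
def runForm (x : Γ.Place) (l : ℕ) : Γ.NormalWord →₀ k :=
  if l + 1 < Γ.val x.1 then Finsupp.single (run x l) 1
  else if l + 1 = Γ.val x.1 then Finsupp.single (socle x.source) 1 else 0

variable {k} in
theorem runForm_of_lt {x : Γ.Place} {l : ℕ} (h : l + 1 < Γ.val x.1) :
    runForm k x l = Finsupp.single (run x l) 1 := if_pos h

variable {k} in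
theorem runForm_of_eq {x : Γ.Place} {l : ℕ} (h : l + 1 = Γ.val x.1) :
    runForm k x l = Finsupp.single (socle x.source) 1 := by
  rw [runForm, if_neg h.not_lt, if_pos h]

variable {k} in
theorem runForm_of_gt {x : Γ.Place} {l : ℕ} (h : Γ.val x.1 < l + 1) : runForm k x l = 0 := by
  rw [runForm, if_neg h.not_gt, if_neg h.ne']

/-- Left multiplication by the arrow at `y`, on normal words. -/
def leftArrow (y : Γ.Place) : Module.End k (Γ.NormalWord →₀ k) :=
  Finsupp.linearCombination k fun b => match b with
    | vertex i => if y.next.source = i then runForm k y 0 else 0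
    | run x l => if y.next = x then runForm k y (l + 1) else 0
    | socle _ => 0

/-- Right multiplication by the arrow at `y`, on normal words. -/
def rightArrow (y : Γ.Place) : Module.End k (Γ.NormalWord →₀ k) :=
  Finsupp.linearCombination k fun b => match b with
    | vertex i => if y.source = i then runForm k y 0 else 0
    | run x l => if Place.next^[l + 1] x = y then runForm k x (l + 1) else 0
    | socle _ => 0

/-- Left multiplication by the trivial path at `i`, on normal words. -/
def leftVertex (i : Γ.QVertex) : Module.End k (Γ.NormalWord →₀ k) :=
  Finsupp.linearCombination k fun b => if b.head = i then Finsupp.single b 1 else 0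

/-- Right multiplication by the trivial path at `i`, on normal words. -/
def rightVertex (i : Γ.QVertex) : Module.End k (Γ.NormalWord →₀ k) :=
  Finsupp.linearCombination k fun b => if b.tail = i then Finsupp.single b 1 else 0

section action

variable {k}

theorem leftArrow_vertex (y : Γ.Place) (i : Γ.QVertex) :
    leftArrow k y (Finsupp.single (vertex i) 1) =
      if y.next.source = i then runForm k y 0 else 0 := by
  simp [leftArrow]

theorem leftArrow_run (y x : Γ.Place) (l : ℕ) :
    leftArrow k y (Finsupp.single (run x l) 1) =
      if y.next = x then runForm k y (l + 1) else 0 := by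
  simp [leftArrow]

theorem leftArrow_socle (y : Γ.Place) (i : Γ.QVertex) :
    leftArrow k y (Finsupp.single (socle i) 1) = 0 := by
  simp [leftArrow]

theorem rightArrow_vertex (y : Γ.Place) (i : Γ.QVertex) :
    rightArrow k y (Finsupp.single (vertex i) 1) =
      if y.source = i then runForm k y 0 else 0 := by
  simp [rightArrow]

theorem rightArrow_run (y x : Γ.Place) (l : ℕ) :
    rightArrow k y (Finsupp.single (run x l) 1) =
      if Place.next^[l + 1] x = y then runForm k x (l + 1) else 0 := by
  simp [rightArrow]

theorem rightArrow_socle (y : Γ.Place) (i : Γ.QVertex) :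
    rightArrow k y (Finsupp.single (socle i) 1) = 0 := by
  simp [rightArrow]

theorem leftVertex_single (i : Γ.QVertex) (b : Γ.NormalWord) :
    leftVertex k i (Finsupp.single b 1) = if b.head = i then Finsupp.single b 1 else 0 := by
  simp [leftVertex]

theorem rightVertex_single (i : Γ.QVertex) (b : Γ.NormalWord) :
    rightVertex k i (Finsupp.single b 1) = if b.tail = i then Finsupp.single b 1 else 0 := by
  simp [rightVertex]

/-- One more arrow turns a run lacking a single arrow into the socle, and the socle into 0. With
these conventions in `runForm`, one formula covers all lengths. The cutoff is the same on both sides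
because `y` and `y.next` belong to the same letter. -/
theorem leftArrow_runForm (y x : Γ.Place) (l : ℕ) :
    leftArrow k y (runForm k x l) = if y.next = x then runForm k y (l + 1) else 0 := by
  have hval : y.next = x → Γ.val x.1 = Γ.val y.1 := fun h => by rw [← h, Place.next_fst]
  rcases lt_trichotomy (l + 1) (Γ.val x.1) with h | h | h
  · rw [runForm_of_lt h, leftArrow_run]
  · rw [runForm_of_eq h, leftArrow_socle]
    split_ifs with hy
    · rw [runForm_of_gt (by rw [← hval hy]; omega)]
    · rfl
  · rw [runForm_of_gt h, map_zero]
    split_ifs with hy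
    · rw [runForm_of_gt (by rw [← hval hy]; omega)]
    · rfl

theorem rightArrow_runForm (y x : Γ.Place) (l : ℕ) :
    rightArrow k y (runForm k x l) =
      if Place.next^[l + 1] x = y then runForm k x (l + 1) else 0 := by
  rcases lt_trichotomy (l + 1) (Γ.val x.1) with h | h | h
  · rw [runForm_of_lt h, rightArrow_run]
  · rw [runForm_of_eq h, rightArrow_socle, runForm_of_gt (by omega), ite_self]
  · rw [runForm_of_gt h, map_zero, runForm_of_gt (by omega), ite_self]

theorem leftVertex_runForm (i : Γ.QVertex) (x : Γ.Place) (l : ℕ) :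
    leftVertex k i (runForm k x l) = if x.source = i then runForm k x l else 0 := by
  unfold runForm
  split_ifs <;> simp_all [leftVertex_single, head]

theorem rightVertex_runForm (i : Γ.QVertex) (x : Γ.Place) (l : ℕ) :
    rightVertex k i (runForm k x l) =
      if (Place.next^[l + 1] x).source = i then runForm k x l else 0 := by
  rcases lt_trichotomy (l + 1) (Γ.val x.1) with h | h | h
  · rw [runForm_of_lt h, rightVertex_single, tail]
  · rw [runForm_of_eq h, rightVertex_single, tail, h, Place.next_iterate_val]
  · rw [runForm_of_gt h, map_zero, ite_self]

theorem end_ext {f g : Module.End k (Γ.NormalWord →₀ k)}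
    (h : ∀ b, f (Finsupp.single b 1) = g (Finsupp.single b 1)) : f = g := by
  refine Finsupp.lhom_ext' fun b => LinearMap.ext_ring ?_
  simpa using h b

/-- This is associativity on labels. It later lets right multiplication be computed from its effect
on the unit. -/
theorem leftArrow_commute_rightArrow (y z : Γ.Place) :
    leftArrow k y * rightArrow k z = rightArrow k z * leftArrow k y := by
  refine end_ext fun b => ?_
  simp only [Module.End.mul_apply]
  cases b with
  | vertex i =>
    rw [rightArrow_vertex, leftArrow_vertex, apply_ite (leftArrow k y), apply_ite (rightArrow k z),
      leftArrow_runForm, rightArrow_runForm, map_zero, map_zero]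
    by_cases h : y.next = z
    · subst h; simp
    · simp [h]
  | run x l =>
    rw [rightArrow_run, leftArrow_run, apply_ite (leftArrow k y), apply_ite (rightArrow k z),
      leftArrow_runForm, rightArrow_runForm, map_zero, map_zero]
    by_cases h : y.next = x
    · subst h
      rw [Function.iterate_succ_apply _ (l + 1) y, if_pos rfl, if_pos rfl]
    · simp [h]
  | socle i => rw [rightArrow_socle, leftArrow_socle, map_zero, map_zero]

theorem leftVertex_commute_rightArrow (i : Γ.QVertex) (z : Γ.Place) :
    leftVertex k i * rightArrow k z = rightArrow k z * leftVertex k i := by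
  refine end_ext fun b => ?_
  simp only [Module.End.mul_apply]
  rw [leftVertex_single, apply_ite (rightArrow k z), map_zero]
  cases b with
  | vertex j =>
    rw [rightArrow_vertex, apply_ite (leftVertex k i), leftVertex_runForm, map_zero, head]
    split_ifs <;> simp_all
  | run x l =>
    rw [rightArrow_run, apply_ite (leftVertex k i), leftVertex_runForm, map_zero, head]
    split_ifs <;> simp_all
  | socle j => rw [rightArrow_socle, map_zero, ite_self]

theorem leftArrow_commute_rightVertex (y : Γ.Place) (i : Γ.QVertex) :
    leftArrow k y * rightVertex k i = rightVertex k i * leftArrow k y := by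
  refine end_ext fun b => ?_
  simp only [Module.End.mul_apply]
  rw [rightVertex_single, apply_ite (leftArrow k y), map_zero]
  cases b with
  | vertex j =>
    rw [leftArrow_vertex, apply_ite (rightVertex k i), rightVertex_runForm, map_zero, tail]
    simp only [zero_add, Function.iterate_one]
    split_ifs <;> simp_all
  | run x l =>
    rw [leftArrow_run, apply_ite (rightVertex k i), rightVertex_runForm, map_zero, tail,
      Function.iterate_succ_apply]
    split_ifs <;> simp_all
  | socle j => rw [leftArrow_socle, map_zero, ite_self]

theorem leftVertex_commute_rightVertex (i j : Γ.QVertex) :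
    leftVertex k i * rightVertex k j = rightVertex k j * leftVertex k i := by
  refine end_ext fun b => ?_
  simp only [Module.End.mul_apply]
  rw [leftVertex_single, rightVertex_single]
  split_ifs <;> simp_all [leftVertex_single, rightVertex_single]

theorem leftVertex_mul_self (i : Γ.QVertex) :
    leftVertex k i * leftVertex k i = leftVertex k i := by
  refine end_ext fun b => ?_
  rw [Module.End.mul_apply, leftVertex_single]
  split_ifs with h
  · rw [leftVertex_single, if_pos h]
  · rw [map_zero]

theorem leftVertex_mul_of_ne (i j : Γ.QVertex) (hij : i ≠ j) :
    leftVertex k i * leftVertex k j = 0 := by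
  refine end_ext fun b => ?_
  rw [Module.End.mul_apply, leftVertex_single]
  split_ifs with h
  · rw [leftVertex_single, if_neg fun h' => hij (h'.symm.trans h), LinearMap.zero_apply]
  · rw [map_zero, LinearMap.zero_apply]

theorem sum_leftVertex : ∑ i : Γ.QVertex, leftVertex k i = 1 := by
  refine end_ext fun b => ?_
  simp [LinearMap.sum_apply, leftVertex_single]

theorem leftVertex_mul_leftArrow (y : Γ.Place) :
    leftVertex k y.source * leftArrow k y = leftArrow k y := by
  refine end_ext fun b => ?_
  rw [Module.End.mul_apply]
  cases b with
  | vertex j =>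
    rw [leftArrow_vertex, apply_ite (leftVertex k _), leftVertex_runForm, map_zero, if_pos rfl]
  | run x l =>
    rw [leftArrow_run, apply_ite (leftVertex k _), leftVertex_runForm, map_zero, if_pos rfl]
  | socle j => rw [leftArrow_socle, map_zero]

theorem leftArrow_mul_leftVertex (y : Γ.Place) :
    leftArrow k y * leftVertex k y.next.source = leftArrow k y := by
  refine end_ext fun b => ?_
  rw [Module.End.mul_apply, leftVertex_single, apply_ite (leftArrow k y), map_zero]
  cases b with
  | vertex j =>
    rw [leftArrow_vertex, head]
    split_ifs <;> simp_all
  | run x l =>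
    rw [leftArrow_run, head]
    split_ifs <;> simp_all
  | socle j => rw [leftArrow_socle, ite_self]

/-- The representation of the path algebra on normal words. -/
def pathAction (k : Type w) [Field k] (Γ : BrauerConfiguration V ι) :
    PathAlgebra k Γ.QVertex →ₐ[k] Module.End k (Γ.NormalWord →₀ k) :=
  PathAlgebra.lift (leftVertex k) (fun _ _ a => leftArrow k a.1) leftVertex_mul_self
    leftVertex_mul_of_ne sum_leftVertex
    (by rintro i j ⟨x, rfl, rfl⟩; exact leftArrow_mul_leftVertex x)

theorem pathAction_nil (i : Γ.QVertex) :
    pathAction k Γ (PathAlgebra.ofPath (Quiver.Path.nil : Quiver.Path i i)) = leftVertex k i :=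
  PathAlgebra.lift_nil ..

theorem pathAction_arrow (x : Γ.Place) : pathAction k Γ (x.arrow k) = leftArrow k x :=
  PathAlgebra.lift_toPath _ _ _ _ _ _ _ (leftVertex_mul_leftArrow x)

theorem runProd_leftArrow_vertex (x : Γ.Place) (n : ℕ) (i : Γ.QVertex) :
    runProd (leftArrow k) x (n + 1) (Finsupp.single (vertex i) 1) =
      if (Place.next^[n + 1] x).source = i then runForm k x n else 0 := by
  induction n generalizing x with
  | zero => rw [runProd_one, leftArrow_vertex, Function.iterate_succ_apply,
      Function.iterate_zero_apply]
  | succ n ih =>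
    rw [runProd_succ, Module.End.mul_apply, ih, apply_ite (leftArrow k x), leftArrow_runForm,
      map_zero, if_pos rfl, ← Function.iterate_succ_apply]

theorem runProd_leftArrow_run (x z : Γ.Place) (n l : ℕ) :
    runProd (leftArrow k) x (n + 1) (Finsupp.single (run z l) 1) =
      if Place.next^[n + 1] x = z then runForm k x (l + (n + 1)) else 0 := by
  induction n generalizing x with
  | zero => rw [runProd_one, leftArrow_run, Function.iterate_succ_apply,
      Function.iterate_zero_apply]
  | succ n ih =>
    rw [runProd_succ, Module.End.mul_apply, ih, apply_ite (leftArrow k x), leftArrow_runForm,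
      map_zero, if_pos rfl, ← Function.iterate_succ_apply, Nat.add_assoc l]

theorem runProd_leftArrow_socle (x : Γ.Place) (n : ℕ) (i : Γ.QVertex) :
    runProd (leftArrow k) x (n + 1) (Finsupp.single (socle i) 1) = 0 := by
  induction n generalizing x with
  | zero => rw [runProd_one, leftArrow_socle]
  | succ n ih => rw [runProd_succ, Module.End.mul_apply, ih, map_zero]

/-- The action of special cycles: they send trivial paths to the socle and kill everything else. -/
theorem runProd_leftArrow_val (x : Γ.Place) :
    runProd (leftArrow k) x (Γ.val x.1) = Finsupp.linearCombination k fun b : Γ.NormalWord =>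
      match b with
      | vertex i => if x.source = i then Finsupp.single (socle x.source) 1 else 0
      | run _ _ => 0
      | socle _ => 0 := by
  obtain ⟨n, hn⟩ := Nat.exists_eq_succ_of_ne_zero x.val_pos.ne'
  rw [Nat.succ_eq_add_one] at hn
  refine end_ext fun b => ?_
  rw [Finsupp.linearCombination_single, one_smul]
  cases b with
  | vertex i =>
    rw [hn, runProd_leftArrow_vertex, ← hn, Place.next_iterate_val, runForm_of_eq hn.symm]
  | run z l => rw [hn, runProd_leftArrow_run, runForm_of_gt (by omega), ite_self]
  | socle i => rw [hn, runProd_leftArrow_socle]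

theorem pathAction_cycle (x : Γ.Place) :
    pathAction k Γ (x.cycle k) = runProd (leftArrow k) x (Γ.val x.1) := by
  have h := map_runProd (fun y : Γ.Place => y.arrow k)
    (pathAction k Γ : PathAlgebra k Γ.QVertex →* Module.End k (Γ.NormalWord →₀ k)) x (Γ.val x.1)
  simp only [MonoidHom.coe_coe, pathAction_arrow] at h
  exact h

/-- All special cycles at a polygon act alike: they send its trivial path to the socle and kill
every other label. An arrow maps labels to run forms, which have no trivial-path part, so a cycle
applied after it gives 0. The arrow at `y` yields only run forms starting at `y`, and these are
killed by any arrow whose next place is not `y`. -/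
theorem pathAction_relations (hμ : ∀ a, Γ.μ a = 1) {r : PathAlgebra k Γ.QVertex}
    (hr : r ∈ Γ.Relations k) : pathAction k Γ r = 0 := by
  cases hr with
  | cycle_sub x y h =>
    have h' : x.source = y.source := h
    rw [hμ, hμ, pow_one, pow_one, map_sub, pathAction_cycle, pathAction_cycle,
      runProd_leftArrow_val, runProd_leftArrow_val, h', sub_self]
  | cycle_mul x =>
    rw [hμ, pow_one, map_mul, pathAction_cycle, pathAction_arrow]
    refine end_ext fun b => ?_
    rw [Module.End.mul_apply, LinearMap.zero_apply]
    have key : ∀ l, runProd (leftArrow k) x (Γ.val x.1) (runForm k x l) = 0 := by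
      intro l
      rcases lt_trichotomy (l + 1) (Γ.val x.1) with h | h | h
      · rw [runForm_of_lt h, runProd_leftArrow_val, Finsupp.linearCombination_single, smul_zero]
      · rw [runForm_of_eq h, runProd_leftArrow_val, Finsupp.linearCombination_single, smul_zero]
      · rw [runForm_of_gt h, map_zero]
    cases b with
    | vertex i =>
      rw [leftArrow_vertex]
      split_ifs
      exacts [key _, map_zero _]
    | run z l =>
      rw [leftArrow_run]
      split_ifs
      exacts [key _, map_zero _]
    | socle i => rw [leftArrow_socle, map_zero]
  | arrow_mul x y h hne =>
    rw [map_mul, pathAction_arrow, pathAction_arrow]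
    refine end_ext fun b => ?_
    rw [Module.End.mul_apply, LinearMap.zero_apply]
    cases b with
    | vertex i =>
      rw [leftArrow_vertex, apply_ite (leftArrow k x), leftArrow_runForm, if_neg hne.symm,
        map_zero, ite_self]
    | run z l =>
      rw [leftArrow_run, apply_ite (leftArrow k x), leftArrow_runForm, if_neg hne.symm,
        map_zero, ite_self]
    | socle i => rw [leftArrow_socle, map_zero]

end action

end BrauerConfiguration

namespace BrauerConfiguration

open NormalWord Classical

variable {V : Type u} [DecidableEq V] {ι : Type v} [Fintype ι] [DecidableEq ι]
  {Γ : BrauerConfiguration V ι} {k : Type w} [Field k]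

/-! ### The Brauer configuration algebra and its normal forms -/

variable (Γ k) in
/-- The quotient map from the path algebra to the Brauer configuration algebra. -/
def toBrauer : PathAlgebra k Γ.QVertex →ₐ[k] Γ.BrauerAlgebra k :=
  RingQuot.mkAlgHom k _

theorem toBrauer_surjective : Function.Surjective (toBrauer Γ k) :=
  RingQuot.mkAlgHom_surjective k _

theorem toBrauer_relations {r : PathAlgebra k Γ.QVertex} (hr : r ∈ Γ.Relations k) :
    toBrauer Γ k r = 0 :=
  (RingQuot.mkAlgHom_rel k (s := fun a b => a ∈ Γ.Relations k ∧ b = 0) ⟨hr, rfl⟩).trans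
    (map_zero (toBrauer Γ k))

variable (k) in
/-- The trivial path at `i`, in the Brauer configuration algebra. -/
def idem (i : Γ.QVertex) : Γ.BrauerAlgebra k :=
  toBrauer Γ k (PathAlgebra.ofPath (Quiver.Path.nil : Quiver.Path i i))

variable (k) in
/-- The arrow at `x`, in the Brauer configuration algebra. -/
def arr (x : Γ.Place) : Γ.BrauerAlgebra k := toBrauer Γ k (x.arrow k)

/-- The Brauer configuration algebra is generated by the trivial paths and the arrows. -/
theorem mem_of_idem_arr_mem (S : Subalgebra k (Γ.BrauerAlgebra k)) (hidem : ∀ i, idem k i ∈ S)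
    (harr : ∀ x, arr k x ∈ S) (a : Γ.BrauerAlgebra k) : a ∈ S := by
  obtain ⟨a, rfl⟩ := toBrauer_surjective a
  refine PathAlgebra.mem_of_generators_mem (S.comap (toBrauer Γ k)) hidem ?_ a
  rintro i j ⟨x, rfl, rfl⟩
  exact harr x

theorem sum_idem : ∑ i : Γ.QVertex, idem k i = 1 := by
  unfold idem
  rw [← map_sum, PathAlgebra.sum_ofPath_nil, map_one]

theorem idem_mul_idem (i j : Γ.QVertex) :
    idem k i * idem k j = if j = i then idem k j else 0 := by
  unfold idem
  rw [← map_mul]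
  split_ifs with h
  · subst h
    rw [PathAlgebra.ofPath_mul_ofPath, Quiver.Path.comp_nil]
  · rw [PathAlgebra.ofPath_mul_ofPath_of_ne _ _ (Ne.symm h), map_zero]

theorem idem_mul_arr (i : Γ.QVertex) (x : Γ.Place) :
    idem k i * arr k x = if x.source = i then arr k x else 0 := by
  unfold idem arr Place.arrow
  rw [← map_mul]
  split_ifs with h
  · subst h
    exact congrArg _ ((PathAlgebra.ofPath_mul_ofPath (Q := Γ.QVertex) _ _).trans
      (congrArg _ (Quiver.Path.nil_comp _)))
  · exact (congrArg _ (PathAlgebra.ofPath_mul_ofPath_of_ne (Q := Γ.QVertex) _ _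
      (Ne.symm h))).trans (map_zero _)

theorem arr_mul_idem (i : Γ.QVertex) (x : Γ.Place) :
    arr k x * idem k i = if x.next.source = i then arr k x else 0 := by
  unfold idem arr Place.arrow
  rw [← map_mul]
  split_ifs with h
  · subst h
    exact congrArg _ ((PathAlgebra.ofPath_mul_ofPath (Q := Γ.QVertex) _ _).trans
      (congrArg _ (Quiver.Path.comp_nil _)))
  · exact (congrArg _ (PathAlgebra.ofPath_mul_ofPath_of_ne (Q := Γ.QVertex) _ _ h)).trans
      (map_zero _)

theorem arr_mul_arr_of_ne {x y : Γ.Place} (h : x.next ≠ y) : arr k x * arr k y = 0 := by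
  unfold arr
  rw [← map_mul]
  by_cases hs : x.next.poly = y.poly
  · exact toBrauer_relations (Relations.arrow_mul x y hs h.symm)
  · exact (congrArg _ (PathAlgebra.ofPath_mul_ofPath_of_ne (Q := Γ.QVertex) _ _ hs)).trans
      (map_zero _)

theorem toBrauer_cycle (x : Γ.Place) : toBrauer Γ k (x.cycle k) = runProd (arr k) x (Γ.val x.1) :=
  map_runProd (fun y : Γ.Place => y.arrow k)
    (toBrauer Γ k : PathAlgebra k Γ.QVertex →* Γ.BrauerAlgebra k) x (Γ.val x.1)

theorem runProd_arr_val_eq (hμ : ∀ a, Γ.μ a = 1) {x y : Γ.Place} (h : x.source = y.source) :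
    runProd (arr k) x (Γ.val x.1) = runProd (arr k) y (Γ.val y.1) := by
  have := toBrauer_relations (Relations.cycle_sub (k := k) x y h)
  rwa [hμ, hμ, pow_one, pow_one, map_sub, sub_eq_zero, toBrauer_cycle, toBrauer_cycle] at this

theorem runProd_arr_of_gt (hμ : ∀ a, Γ.μ a = 1) {x : Γ.Place} {n : ℕ} (h : Γ.val x.1 < n) :
    runProd (arr k) x n = 0 := by
  have := toBrauer_relations (Relations.cycle_mul (k := k) x)
  rw [hμ, pow_one, map_mul, toBrauer_cycle] at this
  obtain ⟨r, rfl⟩ := Nat.exists_eq_add_of_lt h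
  rw [Nat.add_assoc, runProd_add, Place.next_iterate_val, runProd_succ, ← mul_assoc]
  exact (congrArg (· * _) this).trans (zero_mul _)

/-- The length is `n + 1` because the empty product is the unit of the algebra, which starts at no
particular polygon. -/
theorem idem_mul_runProd (i : Γ.QVertex) (x : Γ.Place) (n : ℕ) :
    idem k i * runProd (arr k) x (n + 1) =
      if x.source = i then runProd (arr k) x (n + 1) else 0 := by
  rw [runProd_succ, ← mul_assoc, idem_mul_arr, ite_mul, zero_mul]

theorem arr_mul_runProd (y x : Γ.Place) (n : ℕ) :
    arr k y * runProd (arr k) x (n + 1) =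
      if y.next = x then runProd (arr k) y (n + 2) else 0 := by
  split_ifs with h
  · rw [runProd_succ _ y, h]
  · rw [runProd_succ, ← mul_assoc, arr_mul_arr_of_ne h, zero_mul]

/-- The action of the Brauer configuration algebra on normal words by left multiplication. -/
def action (hμ : ∀ a, Γ.μ a = 1) :
    Γ.BrauerAlgebra k →ₐ[k] Module.End k (Γ.NormalWord →₀ k) :=
  RingQuot.liftAlgHom k ⟨pathAction k Γ, by
    rintro a b ⟨h, rfl⟩
    rw [pathAction_relations hμ h, map_zero]⟩

theorem action_toBrauer (hμ : ∀ a, Γ.μ a = 1) (a : PathAlgebra k Γ.QVertex) :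
    action hμ (toBrauer Γ k a) = pathAction k Γ a :=
  RingQuot.liftAlgHom_mkAlgHom_apply ..

theorem action_idem (hμ : ∀ a, Γ.μ a = 1) (i : Γ.QVertex) :
    action hμ (idem k i) = leftVertex k i :=
  (action_toBrauer hμ _).trans (pathAction_nil i)

theorem action_arr (hμ : ∀ a, Γ.μ a = 1) (x : Γ.Place) :
    action hμ (arr k x) = leftArrow k x :=
  (action_toBrauer hμ _).trans (pathAction_arrow x)

variable (Γ k) in
/-- The normal form of the unit. -/
def unitForm : Γ.NormalWord →₀ k := ∑ i : Γ.QVertex, Finsupp.single (vertex i) 1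

/-- The normal form of an element of the Brauer configuration algebra. -/
def normalForm (hμ : ∀ a, Γ.μ a = 1) : Γ.BrauerAlgebra k →ₗ[k] Γ.NormalWord →₀ k :=
  (action hμ).toLinearMap.flip (unitForm Γ k)

theorem normalForm_apply (hμ : ∀ a, Γ.μ a = 1) (a : Γ.BrauerAlgebra k) :
    normalForm hμ a = action hμ a (unitForm Γ k) := rfl

theorem normalForm_mul (hμ : ∀ a, Γ.μ a = 1) (a b : Γ.BrauerAlgebra k) :
    normalForm hμ (a * b) = action hμ a (normalForm hμ b) := by
  simp only [normalForm_apply, map_mul, Module.End.mul_apply]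

theorem normalForm_one (hμ : ∀ a, Γ.μ a = 1) : normalForm hμ 1 = unitForm Γ k := by
  rw [normalForm_apply, map_one, Module.End.one_apply]

theorem normalForm_arr (hμ : ∀ a, Γ.μ a = 1) (x : Γ.Place) :
    normalForm hμ (arr k x) = runForm k x 0 := by
  rw [normalForm_apply, action_arr, unitForm, map_sum]
  simp [leftArrow_vertex]

theorem normalForm_idem (hμ : ∀ a, Γ.μ a = 1) (i : Γ.QVertex) :
    normalForm hμ (idem k i) = Finsupp.single (vertex i) 1 := by
  rw [normalForm_apply, action_idem, unitForm, map_sum]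
  simp only [leftVertex_single, head]
  exact (Finset.sum_eq_single i (fun j _ hj => if_neg hj) (by simp)).trans (if_pos rfl)

theorem normalForm_runProd (hμ : ∀ a, Γ.μ a = 1) (x : Γ.Place) (l : ℕ) :
    normalForm hμ (runProd (arr k) x (l + 1)) = runForm k x l := by
  induction l generalizing x with
  | zero => rw [runProd_one, normalForm_arr]
  | succ l ih => rw [runProd_succ, normalForm_mul, ih, action_arr, leftArrow_runForm, if_pos rfl]

theorem rightArrow_unitForm (y : Γ.Place) : rightArrow k y (unitForm Γ k) = runForm k y 0 := by
  rw [unitForm, map_sum]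
  simp [rightArrow_vertex]

theorem rightVertex_unitForm (i : Γ.QVertex) :
    rightVertex k i (unitForm Γ k) = Finsupp.single (vertex i) 1 := by
  rw [unitForm, map_sum]
  simp only [rightVertex_single, tail]
  exact (Finset.sum_eq_single i (fun j _ hj => if_neg hj) (by simp)).trans (if_pos rfl)

/-- The elements whose action commutes with `T` form a subalgebra, so generators suffice. -/
theorem action_commute (hμ : ∀ a, Γ.μ a = 1) (T : Module.End k (Γ.NormalWord →₀ k))
    (hidem : ∀ i, leftVertex k i * T = T * leftVertex k i)
    (harr : ∀ x, leftArrow k x * T = T * leftArrow k x) (a : Γ.BrauerAlgebra k) :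
    action hμ a * T = T * action hμ a := by
  refine (Subalgebra.mem_centralizer_iff k (s := {T})).1 (mem_of_idem_arr_mem
    ((Subalgebra.centralizer k {T}).comap (action hμ)) ?_ ?_ a) T rfl |>.symm
  · intro i
    rw [Subalgebra.mem_comap, Subalgebra.mem_centralizer_iff, action_idem]
    rintro _ rfl
    exact (hidem i).symm
  · intro x
    rw [Subalgebra.mem_comap, Subalgebra.mem_centralizer_iff, action_arr]
    rintro _ rfl
    exact (harr x).symm

/-- The normal form of an arrow is the right operator applied to the unit form; moving that operator
past the action of `a` gives the claim. -/
theorem normalForm_mul_arr (hμ : ∀ a, Γ.μ a = 1) (a : Γ.BrauerAlgebra k) (y : Γ.Place) :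
    normalForm hμ (a * arr k y) = rightArrow k y (normalForm hμ a) := by
  rw [normalForm_mul, normalForm_arr, ← rightArrow_unitForm, ← Module.End.mul_apply,
    action_commute hμ _ (leftVertex_commute_rightArrow · y) (leftArrow_commute_rightArrow · y)]
  rfl

theorem normalForm_mul_idem (hμ : ∀ a, Γ.μ a = 1) (a : Γ.BrauerAlgebra k) (i : Γ.QVertex) :
    normalForm hμ (a * idem k i) = rightVertex k i (normalForm hμ a) := by
  rw [normalForm_mul, normalForm_idem, ← rightVertex_unitForm, ← Module.End.mul_apply,
    action_commute hμ _ (leftVertex_commute_rightVertex · i)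
      (leftArrow_commute_rightVertex · i)]
  rfl

variable (k) in
/-- The common value of the special cycles at a polygon. -/
def socleElt (i : Γ.QVertex) : Γ.BrauerAlgebra k :=
  runProd (arr k) (Γ.exists_place i).choose (Γ.val (Γ.exists_place i).choose.1)

theorem socleElt_source (hμ : ∀ a, Γ.μ a = 1) (x : Γ.Place) :
    socleElt k x.source = runProd (arr k) x (Γ.val x.1) :=
  runProd_arr_val_eq hμ (Γ.exists_place x.source).choose_spec

theorem normalForm_socleElt (hμ : ∀ a, Γ.μ a = 1) (i : Γ.QVertex) :
    normalForm hμ (socleElt k i) = Finsupp.single (socle i) 1 := by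
  obtain ⟨x, rfl⟩ := Γ.exists_place i
  obtain ⟨n, hn⟩ := Nat.exists_eq_succ_of_ne_zero x.val_pos.ne'
  rw [socleElt_source hμ, hn, normalForm_runProd, runForm_of_eq hn.symm]

/-- The element of the Brauer configuration algebra with given coefficients. -/
def ofForm : (Γ.NormalWord →₀ k) →ₗ[k] Γ.BrauerAlgebra k :=
  Finsupp.linearCombination k fun b => match b with
    | vertex i => idem k i
    | run x l => if l + 1 < Γ.val x.1 then runProd (arr k) x (l + 1) else 0
    | socle i => socleElt k i

theorem ofForm_vertex (i : Γ.QVertex) : ofForm (Finsupp.single (vertex i) 1) = idem k i := by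
  simp [ofForm]

theorem ofForm_run (x : Γ.Place) (l : ℕ) : ofForm (Finsupp.single (run x l) 1) =
    if l + 1 < Γ.val x.1 then runProd (arr k) x (l + 1) else 0 := by
  simp [ofForm]

theorem ofForm_socle (i : Γ.QVertex) : ofForm (Finsupp.single (socle i) 1) = socleElt k i := by
  simp [ofForm]

theorem ofForm_runForm (hμ : ∀ a, Γ.μ a = 1) (x : Γ.Place) (l : ℕ) :
    ofForm (runForm k x l) = runProd (arr k) x (l + 1) := by
  rcases lt_trichotomy (l + 1) (Γ.val x.1) with h | h | h
  · rw [runForm_of_lt h, ofForm_run, if_pos h]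
  · rw [runForm_of_eq h, ofForm_socle, socleElt_source hμ, h]
  · rw [runForm_of_gt h, map_zero, runProd_arr_of_gt hμ h]

theorem ofForm_unitForm : ofForm (unitForm Γ k) = 1 := by
  simp only [unitForm, map_sum, ofForm_vertex, sum_idem]

theorem idem_mul_ofForm (i : Γ.QVertex) (c : Γ.NormalWord →₀ k) :
    idem k i * ofForm c = ofForm (leftVertex k i c) := by
  suffices h : LinearMap.mulLeft k (idem k i) ∘ₗ ofForm = ofForm ∘ₗ leftVertex k i from
    LinearMap.congr_fun h c
  refine Finsupp.lhom_ext' fun b => LinearMap.ext_ring ?_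
  simp only [LinearMap.comp_apply, Finsupp.lsingle_apply, LinearMap.mulLeft_apply,
    leftVertex_single, apply_ite ofForm, map_zero]
  cases b with
  | vertex j => rw [ofForm_vertex, idem_mul_idem, head]
  | run x l => rw [ofForm_run, mul_ite, mul_zero, idem_mul_runProd, head]; split_ifs <;> rfl
  | socle j =>
    obtain ⟨x, rfl⟩ := Γ.exists_place j
    obtain ⟨n, hn⟩ := Nat.exists_eq_succ_of_ne_zero
      (Γ.exists_place x.source).choose.val_pos.ne'
    rw [ofForm_socle, socleElt, hn, idem_mul_runProd, (Γ.exists_place x.source).choose_spec, head]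

theorem arr_mul_ofForm (hμ : ∀ a, Γ.μ a = 1) (y : Γ.Place) (c : Γ.NormalWord →₀ k) :
    arr k y * ofForm c = ofForm (leftArrow k y c) := by
  suffices h : LinearMap.mulLeft k (arr k y) ∘ₗ ofForm = ofForm ∘ₗ leftArrow k y from
    LinearMap.congr_fun h c
  refine Finsupp.lhom_ext' fun b => LinearMap.ext_ring ?_
  simp only [LinearMap.comp_apply, Finsupp.lsingle_apply, LinearMap.mulLeft_apply]
  cases b with
  | vertex j =>
    rw [ofForm_vertex, arr_mul_idem, leftArrow_vertex, apply_ite ofForm, map_zero,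
      ofForm_runForm hμ, runProd_one]
  | run x l =>
    rw [ofForm_run, leftArrow_run, apply_ite ofForm, map_zero, ofForm_runForm hμ, mul_ite,
      mul_zero, arr_mul_runProd]
    by_cases h : y.next = x
    · rw [if_pos h]
      split_ifs with hl
      · rfl
      · rw [runProd_arr_of_gt hμ]
        rw [← h, Place.next_fst] at hl
        omega
    · rw [if_neg h, ite_self]
  | socle j =>
    rw [ofForm_socle, leftArrow_socle, map_zero]
    obtain ⟨x, rfl⟩ := Γ.exists_place j
    obtain ⟨n, hn⟩ := Nat.exists_eq_succ_of_ne_zero x.val_pos.ne'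
    rw [socleElt_source hμ, hn, arr_mul_runProd]
    split_ifs with h
    · rw [runProd_arr_of_gt hμ]
      rw [← h, Place.next_fst] at hn
      omega
    · rfl

/-- The elements `a` with this property form a subalgebra containing the generators. Taking `c` to
be the unit form shows that `ofForm` recovers an element from its normal form. -/
theorem mul_ofForm (hμ : ∀ a, Γ.μ a = 1) (a : Γ.BrauerAlgebra k) (c : Γ.NormalWord →₀ k) :
    a * ofForm c = ofForm (action hμ a c) := by
  obtain ⟨a, rfl⟩ := toBrauer_surjective a
  revert c
  refine PathAlgebra.mem_of_generators_mem
    { carrier := {a | ∀ c, toBrauer Γ k a * ofForm c = ofForm (action hμ (toBrauer Γ k a) c)}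
      mul_mem' := ?_
      add_mem' := ?_
      algebraMap_mem' := ?_ } ?_ ?_ a
  · intro a b ha hb c
    rw [map_mul, mul_assoc, hb, ha, map_mul, Module.End.mul_apply]
  · intro a b ha hb c
    rw [map_add, add_mul, hb, ha, map_add, LinearMap.add_apply, map_add]
  · intro r c
    rw [AlgHom.commutes, AlgHom.commutes, ← Algebra.smul_def, Module.algebraMap_end_apply, map_smul]
  · intro i c
    exact (idem_mul_ofForm i c).trans (by rw [← action_idem hμ]; rfl)
  · rintro i j ⟨x, rfl, rfl⟩ c
    exact (arr_mul_ofForm hμ x c).trans (by rw [← action_arr hμ]; rfl)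

/-- An element is determined by its normal form. -/
theorem ofForm_normalForm (hμ : ∀ a, Γ.μ a = 1) (a : Γ.BrauerAlgebra k) :
    ofForm (normalForm hμ a) = a := by
  rw [normalForm_apply, ← mul_ofForm, ofForm_unitForm, mul_one]

theorem normalForm_injective (hμ : ∀ a, Γ.μ a = 1) :
    Function.Injective (normalForm hμ : Γ.BrauerAlgebra k → _) :=
  Function.LeftInverse.injective (ofForm_normalForm hμ)

/-- Labels of runs of a full turn or more stand for no basis element: `ofForm` kills them, and the
values of `ofForm` at all other labels have normal forms that avoid them. -/
theorem normalForm_run_of_ge (hμ : ∀ a, Γ.μ a = 1) (a : Γ.BrauerAlgebra k) {x : Γ.Place} {l : ℕ}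
    (h : Γ.val x.1 ≤ l + 1) : normalForm hμ a (run x l) = 0 := by
  rw [← ofForm_normalForm hμ a]
  generalize normalForm hμ a = c
  suffices h : Finsupp.lapply (run x l) ∘ₗ normalForm hμ ∘ₗ ofForm = 0 from LinearMap.congr_fun h c
  refine Finsupp.lhom_ext' fun b => LinearMap.ext_ring ?_
  simp only [LinearMap.comp_apply, Finsupp.lsingle_apply, Finsupp.lapply_apply,
    LinearMap.zero_apply]
  cases b with
  | vertex j => rw [ofForm_vertex, normalForm_idem, Finsupp.single_eq_of_ne (by simp)]
  | run y r =>
    rw [ofForm_run]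
    split_ifs with hr
    · rw [normalForm_runProd, runForm_of_lt hr, Finsupp.single_eq_of_ne]
      rintro ⟨⟩
      omega
    · rw [map_zero, Finsupp.zero_apply]
  | socle j => rw [ofForm_socle, normalForm_socleElt, Finsupp.single_eq_of_ne (by simp)]

end BrauerConfiguration

namespace BrauerConfiguration

open NormalWord Classical

variable {V : Type u} [DecidableEq V] {ι : Type v} [Fintype ι] [DecidableEq ι]
  {Γ : BrauerConfiguration V ι} {k : Type w} [Field k]

/-! ### The center -/

theorem one_lt_val (hμ : ∀ a, Γ.μ a = 1) (a : V) : 1 < Γ.val a := by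
  have h := Γ.nontruncated a
  rwa [hμ, one_mul] at h

theorem runForm_apply_run (x y : Γ.Place) (l r : ℕ) :
    runForm k x l (run y r) = if l + 1 < Γ.val x.1 ∧ x = y ∧ l = r then 1 else 0 := by
  rcases lt_trichotomy (l + 1) (Γ.val x.1) with h | h | h
  · rw [runForm_of_lt h, Finsupp.single_apply, run.injEq]
    simp [h]
  · rw [runForm_of_eq h, Finsupp.single_apply, if_neg (by simp), if_neg (by omega)]
  · rw [runForm_of_gt h, Finsupp.zero_apply, if_neg (by omega)]

theorem apply_eq_of_single {f g : (Γ.NormalWord →₀ k) →ₗ[k] k}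
    (h : ∀ b, f (Finsupp.single b 1) = g (Finsupp.single b 1)) (c : Γ.NormalWord →₀ k) :
    f c = g c := by
  suffices hfg : f = g by rw [hfg]
  refine Finsupp.lhom_ext' fun b => LinearMap.ext_ring ?_
  simpa using h b

theorem leftVertex_apply (i : Γ.QVertex) (b : Γ.NormalWord) (c : Γ.NormalWord →₀ k) :
    leftVertex k i c b = if b.head = i then c b else 0 := by
  have := apply_eq_of_single (f := Finsupp.lapply b ∘ₗ leftVertex k i)
    (g := if b.head = i then Finsupp.lapply b else 0) (fun b' => by
      rw [LinearMap.comp_apply, leftVertex_single, Finsupp.lapply_apply]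
      by_cases hb : b' = b
      · subst hb
        split_ifs <;> simp
      · split_ifs <;> simp [hb]) c
  rw [LinearMap.comp_apply, Finsupp.lapply_apply] at this
  rw [this]
  split_ifs <;> rfl

theorem rightVertex_apply (i : Γ.QVertex) (b : Γ.NormalWord) (c : Γ.NormalWord →₀ k) :
    rightVertex k i c b = if b.tail = i then c b else 0 := by
  have := apply_eq_of_single (f := Finsupp.lapply b ∘ₗ rightVertex k i)
    (g := if b.tail = i then Finsupp.lapply b else 0) (fun b' => by
      rw [LinearMap.comp_apply, rightVertex_single, Finsupp.lapply_apply]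
      by_cases hb : b' = b
      · subst hb
        split_ifs <;> simp
      · split_ifs <;> simp [hb]) c
  rw [LinearMap.comp_apply, Finsupp.lapply_apply] at this
  rw [this]
  split_ifs <;> rfl

/-- Only a trivial path can be extended to a single arrow. The bound `1 < val` keeps this arrow from
being a whole special cycle, whose normal form would be a socle label. -/
theorem leftArrow_apply_run_zero (y : Γ.Place) (hy : 1 < Γ.val y.1) (c : Γ.NormalWord →₀ k) :
    leftArrow k y c (run y 0) = c (vertex y.next.source) := by
  refine apply_eq_of_single (f := Finsupp.lapply (run y 0) ∘ₗ leftArrow k y)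
    (g := Finsupp.lapply (vertex y.next.source)) (fun b => ?_) c
  rw [LinearMap.comp_apply, Finsupp.lapply_apply, Finsupp.lapply_apply]
  cases b with
  | vertex i =>
    rw [leftArrow_vertex]
    by_cases h : y.next.source = i
    · subst h
      simp [runForm_apply_run, hy]
    · simp [h]
  | run x l =>
    rw [leftArrow_run]
    split_ifs <;> simp [runForm_apply_run]
  | socle i => simp [leftArrow_socle]

theorem rightArrow_apply_run_zero (y : Γ.Place) (hy : 1 < Γ.val y.1) (c : Γ.NormalWord →₀ k) :
    rightArrow k y c (run y 0) = c (vertex y.source) := by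
  refine apply_eq_of_single (f := Finsupp.lapply (run y 0) ∘ₗ rightArrow k y)
    (g := Finsupp.lapply (vertex y.source)) (fun b => ?_) c
  rw [LinearMap.comp_apply, Finsupp.lapply_apply, Finsupp.lapply_apply]
  cases b with
  | vertex i =>
    rw [rightArrow_vertex]
    by_cases h : y.source = i
    · subst h
      simp [runForm_apply_run, hy]
    · simp [h]
  | run x l =>
    rw [rightArrow_run]
    split_ifs <;> simp [runForm_apply_run]
  | socle i => simp [rightArrow_socle]

theorem leftArrow_apply_run_of_ne {x y : Γ.Place} (h : y ≠ x) (l : ℕ) (c : Γ.NormalWord →₀ k) :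
    leftArrow k y c (run x l) = 0 := by
  refine apply_eq_of_single (f := Finsupp.lapply (run x l) ∘ₗ leftArrow k y)
    (g := 0) (fun b => ?_) c
  rw [LinearMap.comp_apply, Finsupp.lapply_apply, LinearMap.zero_apply]
  cases b with
  | vertex i =>
    rw [leftArrow_vertex]
    split_ifs <;> simp [runForm_apply_run, h]
  | run z r =>
    rw [leftArrow_run]
    split_ifs <;> simp [runForm_apply_run, h]
  | socle i => simp [leftArrow_socle]

/-- The bound on `l` says that the extended run is still shorter than a full turn, so its label is
not replaced by the socle. -/
theorem rightArrow_apply_run_succ {x : Γ.Place} {l : ℕ} (h : l + 2 < Γ.val x.1)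
    (c : Γ.NormalWord →₀ k) :
    rightArrow k (Place.next^[l + 1] x) c (run x (l + 1)) = c (run x l) := by
  refine apply_eq_of_single
    (f := Finsupp.lapply (run x (l + 1)) ∘ₗ rightArrow k (Place.next^[l + 1] x))
    (g := Finsupp.lapply (run x l)) (fun b => ?_) c
  rw [LinearMap.comp_apply, Finsupp.lapply_apply, Finsupp.lapply_apply]
  cases b with
  | vertex i =>
    rw [rightArrow_vertex]
    split_ifs <;> simp [runForm_apply_run]
  | run z r =>
    rw [rightArrow_run]
    by_cases hz : z = x ∧ r = l
    · obtain ⟨rfl, rfl⟩ := hz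
      rw [if_pos rfl, runForm_apply_run, if_pos ⟨h, rfl, rfl⟩, Finsupp.single_eq_same]
    · rw [Finsupp.single_eq_of_ne (by rintro ⟨⟩; exact hz ⟨rfl, rfl⟩)]
      split_ifs
      · rw [runForm_apply_run, if_neg]
        rintro ⟨-, h1, h2⟩
        exact hz ⟨h1, by omega⟩
      · rfl
  | socle i => simp [rightArrow_socle]

/-- An element is central if and only if left and right multiplication by the generators agree on
its normal form. -/
theorem mem_center_iff_normalForm (hμ : ∀ a, Γ.μ a = 1) (a : Γ.BrauerAlgebra k) :
    a ∈ Subalgebra.center k (Γ.BrauerAlgebra k) ↔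
      (∀ i, leftVertex k i (normalForm hμ a) = rightVertex k i (normalForm hμ a)) ∧
      ∀ y, leftArrow k y (normalForm hμ a) = rightArrow k y (normalForm hμ a) := by
  simp only [← normalForm_mul_idem, ← normalForm_mul_arr, ← action_idem hμ, ← action_arr hμ,
    ← normalForm_mul, (normalForm_injective hμ).eq_iff]
  refine ⟨fun h => ⟨fun i => Subalgebra.mem_center_iff.1 h _,
    fun y => Subalgebra.mem_center_iff.1 h _⟩, fun h => ?_⟩
  refine Subalgebra.mem_center_iff.2 fun b => ?_
  refine ((Subalgebra.mem_centralizer_iff k (s := {a})).1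
    (mem_of_idem_arr_mem (Subalgebra.centralizer k {a}) ?_ ?_ b) a rfl).symm
  · intro i
    rw [Subalgebra.mem_centralizer_iff]
    rintro _ rfl
    exact (h.1 i).symm
  · intro x
    rw [Subalgebra.mem_centralizer_iff]
    rintro _ rfl
    exact (h.2 x).symm

variable (Γ) in
/-- The loops of the Brauer quiver. -/
def Loop : Type u := {x : Γ.Place // x.source = x.next.source}

instance [Finite V] : Finite Γ.Loop :=
  have : Finite Γ.Place := inferInstanceAs (Finite (Σ a : V, Fin (Γ.succSeq a).length))
  inferInstanceAs (Finite {x : Γ.Place // x.source = x.next.source})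

instance [Finite V] : Fintype Γ.Loop := Fintype.ofFinite _

variable (k) in
/-- The path that runs around the special cycle of a loop and omits the loop. -/
def loopElt (x : Γ.Loop) : Γ.BrauerAlgebra k := runProd (arr k) x.1.next (Γ.val x.1.1 - 1)

theorem normalForm_loopElt (hμ : ∀ a, Γ.μ a = 1) (x : Γ.Loop) :
    normalForm hμ (loopElt k x) = Finsupp.single (run x.1.next (Γ.val x.1.1 - 2)) 1 := by
  have h := one_lt_val hμ x.1.1
  -- A path of length `val - 1` carries the label `val - 2`, since `run x l` has length `l + 1`; the
  -- truncated subtraction is exact because `1 < val`.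
  rw [loopElt, show Γ.val x.1.1 - 1 = (Γ.val x.1.1 - 2) + 1 by omega, normalForm_runProd,
    runForm_of_lt (by rw [Place.next_fst]; omega)]

theorem socleElt_mem_center (hμ : ∀ a, Γ.μ a = 1) (i : Γ.QVertex) :
    socleElt k i ∈ Subalgebra.center k (Γ.BrauerAlgebra k) := by
  rw [mem_center_iff_normalForm hμ, normalForm_socleElt]
  refine ⟨fun j => ?_, fun y => ?_⟩
  · rw [leftVertex_single, rightVertex_single, head, tail]
  · rw [leftArrow_socle, rightArrow_socle]

/-- The complement of a loop starts and ends at the polygon of the loop. Multiplying by the loop on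
either side completes a special cycle there, hence gives the same socle element; every other arrow
gives 0 on both sides. -/
theorem loopElt_mem_center (hμ : ∀ a, Γ.μ a = 1) (x : Γ.Loop) :
    loopElt k x ∈ Subalgebra.center k (Γ.BrauerAlgebra k) := by
  rw [mem_center_iff_normalForm hμ, normalForm_loopElt]
  have h := one_lt_val hμ x.1.1
  have hnext : Place.next^[Γ.val x.1.1 - 2 + 1] x.1.next = x.1 := by
    rw [← Function.iterate_succ_apply, show (Γ.val x.1.1 - 2 + 1).succ = Γ.val x.1.1 by omega,
      Place.next_iterate_val]
  refine ⟨fun j => ?_, fun y => ?_⟩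
  · rw [leftVertex_single, rightVertex_single, head, tail, hnext, x.2]
  · rw [leftArrow_run, rightArrow_run, hnext]
    by_cases hy : x.1 = y
    · subst hy
      rw [if_pos rfl, if_pos rfl, runForm_of_eq (by omega),
        runForm_of_eq (by rw [Place.next_fst]; omega), x.2]
    · rw [if_neg (fun h' => hy (Place.next_injective h').symm), if_neg hy]

variable (Γ k) in
/-- The linear combinations of the unit, the special cycles and the complements of loops. -/
def centerMap [Finite V] : (k × (Γ.QVertex → k) × (Γ.Loop → k)) →ₗ[k] Γ.BrauerAlgebra k :=
  (LinearMap.toSpanSingleton k _ 1).coprod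
    ((Fintype.linearCombination k (socleElt k)).coprod (Fintype.linearCombination k (loopElt k)))

theorem centerMap_apply [Finite V] (c : k) (s : Γ.QVertex → k) (d : Γ.Loop → k) :
    centerMap Γ k (c, s, d) = c • 1 + (∑ i, s i • socleElt k i + ∑ x, d x • loopElt k x) := by
  simp [centerMap, Fintype.linearCombination_apply]

theorem centerMap_mem_center [Finite V] (hμ : ∀ a, Γ.μ a = 1)
    (p : k × (Γ.QVertex → k) × (Γ.Loop → k)) :
    centerMap Γ k p ∈ Subalgebra.center k (Γ.BrauerAlgebra k) := by
  obtain ⟨c, s, d⟩ := p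
  rw [centerMap_apply]
  refine add_mem (Subalgebra.smul_mem _ (one_mem _) _) (add_mem ?_ ?_)
  · exact sum_mem fun i _ => Subalgebra.smul_mem _ (socleElt_mem_center hμ i) _
  · exact sum_mem fun x _ => Subalgebra.smul_mem _ (loopElt_mem_center hμ x) _

theorem normalForm_centerMap [Finite V] (hμ : ∀ a, Γ.μ a = 1) (c : k) (s : Γ.QVertex → k)
    (d : Γ.Loop → k) : normalForm hμ (centerMap Γ k (c, s, d)) =
      ∑ i, Finsupp.single (vertex i) c + (∑ i, Finsupp.single (socle i) (s i) +
        ∑ x : Γ.Loop, Finsupp.single (run x.1.next (Γ.val x.1.1 - 2)) (d x)) := by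
  rw [centerMap_apply]
  simp only [map_add, map_smul, map_sum, normalForm_one, normalForm_socleElt, normalForm_loopElt,
    unitForm, Finset.smul_sum, Finsupp.smul_single, smul_eq_mul, mul_one]

theorem normalForm_centerMap_vertex [Finite V] (hμ : ∀ a, Γ.μ a = 1) (c : k) (s : Γ.QVertex → k)
    (d : Γ.Loop → k) (i : Γ.QVertex) :
    normalForm hμ (centerMap Γ k (c, s, d)) (vertex i) = c := by
  rw [normalForm_centerMap]
  simp [Finsupp.single_apply]

theorem normalForm_centerMap_socle [Finite V] (hμ : ∀ a, Γ.μ a = 1) (c : k) (s : Γ.QVertex → k)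
    (d : Γ.Loop → k) (i : Γ.QVertex) :
    normalForm hμ (centerMap Γ k (c, s, d)) (socle i) = s i := by
  rw [normalForm_centerMap]
  simp [Finsupp.single_apply]

theorem normalForm_centerMap_loop [Finite V] (hμ : ∀ a, Γ.μ a = 1) (c : k) (s : Γ.QVertex → k)
    (d : Γ.Loop → k) (x : Γ.Loop) :
    normalForm hμ (centerMap Γ k (c, s, d)) (run x.1.next (Γ.val x.1.1 - 2)) = d x := by
  rw [normalForm_centerMap]
  simp only [Finsupp.add_apply, Finsupp.finsetSum_apply]
  rw [Finset.sum_eq_zero, Finset.sum_eq_zero, Finset.sum_eq_single x]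
  · simp
  · intro y _ hy
    refine Finsupp.single_eq_of_ne fun h => hy (Subtype.ext (Place.next_injective ?_))
    exact ((run.injEq ..).mp h).1.symm
  · simp
  · intro i _
    exact Finsupp.single_eq_of_ne (by simp)
  · intro i _
    exact Finsupp.single_eq_of_ne (by simp)

theorem normalForm_centerMap_run [Finite V] (hμ : ∀ a, Γ.μ a = 1) (c : k) (s : Γ.QVertex → k)
    (d : Γ.Loop → k) {x : Γ.Place} {l : ℕ}
    (h : ∀ y : Γ.Loop, y.1.next = x → l ≠ Γ.val y.1.1 - 2) :
    normalForm hμ (centerMap Γ k (c, s, d)) (run x l) = 0 := by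
  rw [normalForm_centerMap]
  simp only [Finsupp.add_apply, Finsupp.finsetSum_apply]
  rw [Finset.sum_eq_zero, Finset.sum_eq_zero, Finset.sum_eq_zero, add_zero, add_zero]
  · intro y _
    refine Finsupp.single_eq_of_ne fun h' => ?_
    obtain ⟨h1, h2⟩ := (run.injEq ..).mp h'
    exact h y h1.symm h2
  · intro i _
    exact Finsupp.single_eq_of_ne (by simp)
  · intro i _
    exact Finsupp.single_eq_of_ne (by simp)

theorem centerMap_injective [Finite V] [Nonempty ι] (hμ : ∀ a, Γ.μ a = 1) :
    Function.Injective (centerMap Γ k) := by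
  rintro ⟨c, s, d⟩ ⟨c', s', d'⟩ h
  have h' := congrArg (normalForm hμ) h
  refine Prod.ext ?_ (Prod.ext (funext fun i => ?_) (funext fun x => ?_))
  -- The coefficient of the unit is visible only at a trivial path, hence the need for some polygon.
  · have i : Γ.QVertex := (Classical.arbitrary ι : ι)
    simpa only [normalForm_centerMap_vertex] using DFunLike.congr_fun h' (vertex i)
  · simpa only [normalForm_centerMap_socle] using DFunLike.congr_fun h' (socle i)
  · simpa only [normalForm_centerMap_loop] using
      DFunLike.congr_fun h' (run x.1.next (Γ.val x.1.1 - 2))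

theorem Place.exists_next_iterate_eq {x y : Γ.Place} (h : x.1 = y.1) : ∃ t, next^[t] x = y := by
  obtain ⟨a, s, hs⟩ := x
  obtain ⟨b, t, ht⟩ := y
  obtain rfl : a = b := h
  -- The walk goes to the end of the list and then on to place `t`, which avoids the possibly
  -- negative difference `t - s`.
  refine ⟨t + ((Γ.succSeq a).length - s), (next_iterate _ _).trans ?_⟩
  have h' : (s + (t + ((Γ.succSeq a).length - s))) % (Γ.succSeq a).length = t := by
    rw [show s + (t + ((Γ.succSeq a).length - s)) = t + (Γ.succSeq a).length by omega,
      Nat.add_mod_right, Nat.mod_eq_of_lt ht]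
  simp only [h']
  rfl

/-- In a connected configuration, a function on polygons that is constant along arrows is
constant. -/
theorem IsConnected.eq_of_forall_next (hΓ : Γ.IsConnected) {α : Type*} (g : ι → α)
    (hg : ∀ x : Γ.Place, g x.poly = g x.next.poly) (i j : ι) : g i = g j := by
  have hiter : ∀ (t : ℕ) (x : Γ.Place), g x.poly = g (Place.next^[t] x).poly := by
    intro t
    induction t with
    | zero => intro x; rfl
    | succ t ih =>
      intro x
      rw [Function.iterate_succ_apply, hg x, ih]
  obtain ⟨w⟩ := hΓ.preconnected i j
  induction w with
  | nil => rfl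
  | cons hadj _ ih =>
    rw [← ih]
    have key : ∀ {i j : ι}, (∃ a, a ∈ Γ.polygon i ∧ a ∈ Γ.polygon j) → g i = g j := by
      rintro i j ⟨a, hi, hj⟩
      obtain ⟨x, hxa, rfl⟩ := Γ.exists_place_of_mem hi
      obtain ⟨y, hya, rfl⟩ := Γ.exists_place_of_mem hj
      obtain ⟨t, rfl⟩ := Place.exists_next_iterate_eq (hxa.trans hya.symm)
      exact hiter t x
    rcases ((SimpleGraph.fromRel_adj ..).1 hadj).2 with h | h
    · exact key h
    · exact (key h).symm

/-- The coefficients of the required combination are read off the normal form; what remains is that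
it has no other nonzero coefficients. -/
theorem mem_range_centerMap [Finite V] (hμ : ∀ a, Γ.μ a = 1) (hΓ : Γ.IsConnected)
    {a : Γ.BrauerAlgebra k} (ha : a ∈ Subalgebra.center k (Γ.BrauerAlgebra k)) :
    a ∈ LinearMap.range (centerMap Γ k) := by
  obtain ⟨hv, harr⟩ := (mem_center_iff_normalForm hμ a).1 ha
  have hconst : ∀ i j : ι, normalForm hμ a (vertex i) = normalForm hμ a (vertex j) := by
    refine hΓ.eq_of_forall_next (fun i : ι => normalForm hμ a (vertex i)) fun x => ?_
    -- The coefficient of the arrow at `x` in the two products is the coefficient of the trivial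
    -- path at its end and at its start, respectively.
    have h := DFunLike.congr_fun (harr x) (run x 0)
    rw [leftArrow_apply_run_zero x (one_lt_val hμ _),
      rightArrow_apply_run_zero x (one_lt_val hμ _)] at h
    exact h.symm
  have i₀ : ι := hΓ.nonempty.some
  refine ⟨(normalForm hμ a (vertex i₀), fun i => normalForm hμ a (socle i),
    fun x => normalForm hμ a (run x.1.next (Γ.val x.1.1 - 2))), normalForm_injective hμ ?_⟩
  ext b
  cases b with
  | vertex i => rw [normalForm_centerMap_vertex]; exact hconst _ _
  | socle i => rw [normalForm_centerMap_socle]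
  | run x l =>
    by_cases hx : ∃ y : Γ.Loop, y.1.next = x ∧ l = Γ.val y.1.1 - 2
    · obtain ⟨y, rfl, rfl⟩ := hx
      rw [normalForm_centerMap_loop]
    · rw [normalForm_centerMap_run hμ _ _ _ fun y h1 h2 => hx ⟨y, h1, h2⟩]
      symm
      rcases lt_trichotomy (l + 2) (Γ.val x.1) with hl | hl | hl
      -- The arrow continuing the run on the right sits at a place other than `x`, so multiplying by
      -- it on the left never gives a run starting at `x`.
      · have h := DFunLike.congr_fun (harr (Place.next^[l + 1] x)) (run x (l + 1))
        rwa [rightArrow_apply_run_succ hl, leftArrow_apply_run_of_ne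
          (Place.next_iterate_ne x (Nat.succ_pos l) (by omega)), eq_comm] at h
      -- Here one arrow is missing from the full turn. Commuting with the trivial path at the start
      -- makes a run with nonzero coefficient closed, so the missing arrow is a loop.
      · have hnext : (Place.next^[l + 1] x).next = x := by
          rw [← Function.iterate_succ_apply' Place.next, Nat.succ_eq_add_one, hl,
            Place.next_iterate_val]
        by_contra hne
        refine hx ⟨⟨Place.next^[l + 1] x, ?_⟩, hnext, ?_⟩
        · have h := DFunLike.congr_fun (hv x.source) (run x l)
          rw [leftVertex_apply, rightVertex_apply, head, tail, if_pos rfl] at h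
          rw [hnext]
          by_contra hs
          rw [if_neg hs] at h
          exact hne h
        · dsimp only
          rw [Place.next_iterate_fst]
          omega
      · exact normalForm_run_of_ge hμ a (by omega)

/-- The dimension of the center of the Brauer configuration algebra of a connected configuration
with trivial multiplicities. -/
theorem finrank_center [Finite V] (hμ : ∀ a, Γ.μ a = 1) (hΓ : Γ.IsConnected) :
    Module.finrank k (Subalgebra.center k (Γ.BrauerAlgebra k)) =
      1 + Fintype.card ι + Nat.card {x : Γ.Place // x.poly = x.next.poly} := by
  have : Nonempty ι := hΓ.nonempty
  have hrange : Subalgebra.toSubmodule (Subalgebra.center k (Γ.BrauerAlgebra k)) =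
      LinearMap.range (centerMap Γ k) := by
    refine le_antisymm (fun a ha => mem_range_centerMap hμ hΓ ha) ?_
    rintro _ ⟨p, rfl⟩
    exact centerMap_mem_center hμ p
  have hcard : Nat.card {x : Γ.Place // x.poly = x.next.poly} = Fintype.card Γ.Loop :=
    Nat.card_eq_fintype_card (α := Γ.Loop)
  rw [← Subalgebra.finrank_toSubmodule, hrange,
    LinearMap.finrank_range_of_inj (centerMap_injective hμ), Module.finrank_prod,
    Module.finrank_prod, Module.finrank_self, Module.finrank_fintype_fun_eq_card,
    Module.finrank_fintype_fun_eq_card, hcard, ← add_assoc]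
  rfl

end BrauerConfiguration

/-! ### Loops of sorted successor sequences -/

/-- In a sorted list with at least two distinct entries, the entries that differ from their cyclic
successor are the last occurrences of the distinct values. -/
theorem List.card_filter_get_ne_cyclic_succ {α : Type*} [LinearOrder α] {s : List α}
    (hs : s.Pairwise (· ≤ ·)) {a b : α} (ha : a ∈ s) (hb : b ∈ s) (hab : a ≠ b) :
    (Finset.univ.filter fun t : Fin s.length =>
      s.get t ≠ s.get ⟨(t + 1) % s.length, Nat.mod_lt _ (Nat.zero_lt_of_lt t.isLt)⟩).card =
      s.toFinset.card := by
  have hmono : ∀ {t r : Fin s.length}, t ≤ r → s.get t ≤ s.get r := by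
    intro t r htr
    rcases htr.eq_or_lt with rfl | h
    · exact le_rfl
    · exact List.pairwise_iff_get.1 hs t r h
  refine Finset.card_nbij (fun t => s.get t) (fun t _ => ?_) ?_ ?_
  · exact List.mem_toFinset.2 (List.get_mem s t)
  -- Sortedness squeezes the entry after `t` between the equal entries at `t` and `r`. Hence a place
  -- that differs from its successor is the last one with its value.
  · have key : ∀ t r : Fin s.length, t < r → s.get t = s.get r →
        s.get t = s.get ⟨(t + 1) % s.length, Nat.mod_lt _ (Nat.zero_lt_of_lt t.isLt)⟩ := by
      intro t r htr h
      have hlt : (t : ℕ) < r := htr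
      have hmod : ((t : ℕ) + 1) % s.length = t + 1 := Nat.mod_eq_of_lt (by omega)
      refine le_antisymm (hmono ?_) (h ▸ hmono ?_)
      · rw [Fin.le_def]; dsimp only; omega
      · rw [Fin.le_def]; dsimp only; omega
    intro t ht r hr h
    simp only [Finset.coe_filter, Finset.mem_univ, true_and, Set.mem_ofPred_eq] at ht hr
    rcases lt_trichotomy t r with htr | htr | htr
    · exact absurd (key t r htr h) ht
    · exact htr
    · exact absurd (key r t htr h.symm) hr
  · intro c hc
    obtain ⟨t₀, ht₀⟩ := List.get_of_mem (List.mem_toFinset.1 hc)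
    -- The preimage of `c` is its last occurrence.
    obtain ⟨t, ht, hmax⟩ := (Finset.univ.filter fun t : Fin s.length => s.get t = c).exists_max_image
      id ⟨t₀, by simpa using ht₀⟩
    simp only [Finset.mem_filter, Finset.mem_univ, true_and, id] at ht hmax
    refine ⟨t, ?_, ht⟩
    simp only [Finset.coe_filter, Finset.mem_univ, true_and, Set.mem_ofPred_eq]
    intro h
    have hle := hmax _ (h.symm.trans ht)
    rw [Fin.le_def] at hle
    dsimp only at hle
    rcases Nat.lt_or_ge (t + 1) s.length with hlt | hge
    · rw [Nat.mod_eq_of_lt hlt] at hle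
      omega
    -- At the final place the successor wraps to the first entry; if the two agreed, the sorted list
    -- would be constant, against `hab`.
    · have hlen : (t : ℕ) + 1 = s.length := by have := t.isLt; omega
      have hall : ∀ x ∈ s, x = c := by
        intro x hx
        obtain ⟨r, rfl⟩ := List.get_of_mem hx
        refine le_antisymm (ht ▸ hmono ?_) (ht ▸ h ▸ hmono ?_)
        · rw [Fin.le_def]; omega
        · rw [Fin.le_def]; dsimp only; rw [hlen, Nat.mod_self]; omega
      exact hab ((hall a ha).trans (hall b hb).symm)

theorem List.card_get_eq_cyclic_succ {α : Type*} [LinearOrder α] {s : List α}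
    (hs : s.Pairwise (· ≤ ·)) {a b : α} (ha : a ∈ s) (hb : b ∈ s) (hab : a ≠ b) :
    Fintype.card {t : Fin s.length //
      s.get t = s.get ⟨(t + 1) % s.length, Nat.mod_lt _ (Nat.zero_lt_of_lt t.isLt)⟩} +
      s.toFinset.card = s.length := by
  rw [← List.card_filter_get_ne_cyclic_succ hs ha hb hab, Fintype.card_subtype,
    Finset.card_filter_add_card_filter_not, Finset.card_univ, Fintype.card_fin]

namespace BrauerConfiguration

/-- For each letter, the loops number its valency minus the number of distinct polygons containing
it. Both are sums over polygons; exchanging the sums over letters and polygons gives the formula. -/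
theorem card_loops {V : Type u} [DecidableEq V] [Fintype V] {ι : Type v} [Fintype ι]
    [LinearOrder ι] (Γ : BrauerConfiguration V ι) (hs : ∀ a, (Γ.succSeq a).Pairwise (· ≤ ·))
    (h2 : ∀ a, ∃ i j, i ≠ j ∧ i ∈ Γ.succSeq a ∧ j ∈ Γ.succSeq a) :
    (Nat.card {x : Γ.Place // x.poly = x.next.poly} : ℤ) =
      ∑ i, ∑ a ∈ (Γ.polygon i).toFinset, (((Γ.polygon i).count a : ℤ) - 1) := by
  let e : {x : Γ.Place // x.poly = x.next.poly} ≃ Σ a : V, {t : Fin (Γ.succSeq a).length //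
      (Γ.succSeq a).get t = (Γ.succSeq a).get
        ⟨(t + 1) % (Γ.succSeq a).length, Nat.mod_lt _ (Nat.zero_lt_of_lt t.isLt)⟩} :=
    { toFun x := ⟨x.1.1, x.1.2, x.2⟩
      invFun x := ⟨⟨x.1, x.2.1⟩, x.2.2⟩
      left_inv _ := rfl
      right_inv _ := rfl }
  rw [Nat.card_congr e, Nat.card_eq_fintype_card, Fintype.card_sigma, Nat.cast_sum]
  have hterm : ∀ a, (Fintype.card {t : Fin (Γ.succSeq a).length //
      (Γ.succSeq a).get t = (Γ.succSeq a).get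
        ⟨(t + 1) % (Γ.succSeq a).length, Nat.mod_lt _ (Nat.zero_lt_of_lt t.isLt)⟩} : ℤ) =
      ∑ i, if a ∈ Γ.polygon i then ((Γ.polygon i).count a : ℤ) - 1 else 0 := by
    intro a
    obtain ⟨i, j, hij, hi, hj⟩ := h2 a
    have h := (List.card_get_eq_cyclic_succ (hs a) hi hj hij).trans (Γ.length_succSeq a)
    have hfin : (Γ.succSeq a).toFinset = Finset.univ.filter fun i => a ∈ Γ.polygon i := by
      ext i
      rw [List.mem_toFinset, ← List.count_pos_iff, Γ.count_succSeq, Multiset.count_pos]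
      simp
    rw [val, hfin] at h
    replace h := congrArg (Nat.cast : ℕ → ℤ) h
    rw [Nat.cast_add] at h
    rw [eq_sub_of_add_eq h, Finset.card_filter]
    push_cast
    rw [← Finset.sum_sub_distrib]
    refine Finset.sum_congr rfl fun i _ => ?_
    split_ifs with ha
    · rfl
    · rw [Multiset.count_eq_zero.2 ha]
      rfl
  simp only [hterm]
  rw [Finset.sum_comm]
  refine Finset.sum_congr rfl fun i _ => ?_
  rw [← Finset.sum_filter]
  refine Finset.sum_congr ?_ fun _ _ => rfl
  ext a
  simp

end BrauerConfiguration

/-! ### The configuration of a Vigenère ciphertext -/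

namespace Vigenere

theorem pairwise_succSeq_configuration {m n N : ℕ} [NeZero m] (y : Fin N → ZMod n)
    (hlen : ∀ i, 1 < (block m y i).length) (hfreq : ∀ j, 1 < (List.ofFn y).count j) (j : ZMod n) :
    ((configuration m y hlen hfreq).succSeq j).Pairwise (· ≤ ·) := by
  refine List.pairwise_flatMap.2 ⟨fun i _ => ?_, ?_⟩
  · exact List.pairwise_replicate.2 (Or.inr le_rfl)
  · refine (List.pairwise_lt_finRange m).imp fun {a b} hab x hx z hz => ?_
    rw [List.eq_of_mem_replicate hx, List.eq_of_mem_replicate hz]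
    exact hab.le

theorem mem_succSeq_configuration {m n N : ℕ} [NeZero m] (y : Fin N → ZMod n)
    (hlen : ∀ i, 1 < (block m y i).length) (hfreq : ∀ j, 1 < (List.ofFn y).count j) {j : ZMod n}
    {i : Fin m} (h : j ∈ block m y i) : i ∈ (configuration m y hlen hfreq).succSeq j := by
  rw [← List.count_pos_iff, BrauerConfiguration.count_succSeq, Multiset.count_pos]
  exact h

theorem finrank_center_configuration (k : Type*) [Field k] {m n N : ℕ} [NeZero m] [NeZero n]
    (y : Fin N → ZMod n) (hlen : ∀ i, 1 < (block m y i).length)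
    (hfreq : ∀ j, 1 < (List.ofFn y).count j)
    (hconn : (configuration m y hlen hfreq).IsConnected)
    (h2 : ∀ j, ∃ i i', i ≠ i' ∧ j ∈ block m y i ∧ j ∈ block m y i') :
    (Module.finrank k (Subalgebra.center k
        ((configuration m y hlen hfreq).BrauerAlgebra k)) : ℤ) =
      1 + m + ∑ i : Fin m, ∑ j ∈ (block m y i).toFinset, (((block m y i).count j : ℤ) - 1) := by
  have hloops := (configuration m y hlen hfreq).card_loops
    (pairwise_succSeq_configuration y hlen hfreq) (fun j => by
      obtain ⟨i, i', hne, hi, hi'⟩ := h2 j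
      exact ⟨i, i', hne, mem_succSeq_configuration y hlen hfreq hi,
        mem_succSeq_configuration y hlen hfreq hi'⟩)
  have h := BrauerConfiguration.finrank_center (k := k) (fun _ => rfl) hconn
  rw [h, Fintype.card_fin]
  push_cast
  rw [add_right_inj]
  refine hloops.trans (Finset.sum_congr rfl fun i _ => Finset.sum_congr ?_ fun j _ => ?_)
  · rfl
  · exact congrArg (fun c : ℕ => (c : ℤ) - 1) (Multiset.coe_count j (block m y i))

theorem isConnected_configuration_of_forall_mem {m n N : ℕ} [NeZero m] (y : Fin N → ZMod n)
    (hlen : ∀ i, 1 < (block m y i).length) (hfreq : ∀ j, 1 < (List.ofFn y).count j)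
    (hall : ∀ i j, j ∈ block m y i) : (configuration m y hlen hfreq).IsConnected := by
  refine { preconnected := fun i i' => ?_, nonempty := ⟨0⟩ }
  by_cases h : i = i'
  · rw [h]
  -- The letter 0 lies in every list, so any two distinct polygons are adjacent.
  · refine SimpleGraph.Adj.reachable ((SimpleGraph.fromRel_adj ..).2 ⟨h, Or.inl ⟨0, ?_, ?_⟩⟩)
    · exact hall i 0
    · exact hall i' 0

end Vigenere

end

theorem theorem3p3 (k : Type*) [Field k] (m n N : ℕ) [NeZero m] [NeZero n]
    (hm : 1 < m) (hn : 1 < n)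
    (K : Fin m → ZMod n) (x y : Fin N → ZMod n) (hy : y = Vigenere.encrypt K x)
    (hlen : ∀ i, 1 < (Vigenere.block m y i).length)
    (hfreq : ∀ j, 1 < (List.ofFn y).count j) :
    ((∀ i j, j ∈ Vigenere.block m y i) →
      (Module.finrank k (Subalgebra.center k
          ((Vigenere.configuration m y hlen hfreq).BrauerAlgebra k)) : ℤ) =
        1 + m + ∑ i : Fin m, ∑ j : ZMod n, (((Vigenere.block m y i).count j : ℤ) - 1)) ∧
    ((Vigenere.configuration m y hlen hfreq).IsConnected →
      (∀ j, ∃ i i', i ≠ i' ∧ j ∈ Vigenere.block m y i ∧ j ∈ Vigenere.block m y i') →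
      (Module.finrank k (Subalgebra.center k
          ((Vigenere.configuration m y hlen hfreq).BrauerAlgebra k)) : ℤ) =
        1 + m + ∑ i : Fin m, ∑ j ∈ (Vigenere.block m y i).toFinset,
          (((Vigenere.block m y i).count j : ℤ) - 1)) := by
  refine ⟨fun hall => ?_, Vigenere.finrank_center_configuration k y hlen hfreq⟩
  -- Part (a) is a case of part (b): a common letter gives connectedness, and since `1 < m` the
  -- lists with indices 0 and 1 are two different lists containing any given letter.
  rw [Vigenere.finrank_center_configuration k y hlen hfreq
    (Vigenere.isConnected_configuration_of_forall_mem y hlen hfreq hall)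
    fun j => ⟨⟨0, by omega⟩, ⟨1, hm⟩, by simp, hall _ j, hall _ j⟩]
  refine congrArg _ (Finset.sum_congr rfl fun i _ => Finset.sum_congr ?_ fun _ _ => rfl)
  exact Finset.eq_univ_of_forall fun j => List.mem_toFinset.2 (hall i j)
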